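/- There are absolute constants $A, B > 0$ and $c \in \mathbb{N}$ such that for all integers $n \ge 3$ and $f \ge 0$ there is a randomized sketch for graphs on $n$ vertices which, applied to a graph $G = (V,E)$ with $|V| = n$, produces a bit string $\mathcal{S}(G)$ of length at most $A \cdot n\sqrt{\max(f,1)} \cdot (\log n)^{c}$ (that is, $\widetilde{O}(n\sqrt{f})$ bits for $f \ge 1$), together with a recovery procedure that is given only $\mathcal{S}(G)$ and a set of deleted edges, such that the following holds. For every graph $G = (V,E)$ on $n$ vertices and every fixed (oblivious, i.e. chosen independently of the randomness of the sketch) set of deletions $F \subseteq E$ with $|F| \le f$, with probability at least $1 - n^{-100}$ over the randomness of the sketch, the graph recovered from $\mathcal{S}(G)$ and $F$ is a $t$-spanner of $G - F$ with $t = B \log n \cdot \log\log n$. Here $\log$ is the natural logarithm, and a $t$-spanner of a graph $G'$ is a subgraph $H$ of $G'$ on the same vertex set with $\mathrm{dist}_H(u,v) \le t \cdot \mathrm{dist}_{G'}(u,v)$ for every pair of vertices $u, v$, where the distance between vertices in different connected components is $+\infty$. -/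

import Mathlib

namespace ObliviousSpanner

/-- `H` is a `t`-spanner of `G`: a subgraph of `G` on the same vertex set with
`dist_H(u,v) ≤ t * dist_G(u,v)` for all `u, v`. Distances are infinite between different
components, so the inequality has content exactly for the pairs that are connected in `G`, and
for these it includes that `u, v` are connected in `H`. (Mathlib's `SimpleGraph.dist` takes the
value `0` on disconnected pairs, hence the explicit reachability conditions.) -/
def IsSpanner {V : Type*} (t : ℝ) (G H : SimpleGraph V) : Prop :=
  H ≤ G ∧ ∀ u v : V, G.Reachable u v →
    H.Reachable u v ∧ (H.dist u v : ℝ) ≤ t * (G.dist u v : ℝ)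

/-- A randomized sketch of `s` bits for graphs on the vertex set `{0, …, n-1}`, with a recovery
procedure whose queries are sets of deleted edges. A random seed is drawn once, independently of
the graph and of the deletions. The sketch is a function of the graph and the seed. Recovery sees
only the `s` bits of the sketch and the deletion set: whatever it needs to know about the graph or
the seed has to be contained in these `s` bits. -/
structure RandomizedSketch (n s : ℕ) where
  /-- the set of possible random seeds -/
  Seed : Type
  /-- the distribution of the seed -/
  seedDist : PMF Seed
  /-- the sketch of a graph, for a given seed -/
  sketch : SimpleGraph (Fin n) → Seed → (Fin s → Bool)
  /-- the graph recovered from a sketch and a set of deleted edges -/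
  recover : (Fin s → Bool) → Finset (Sym2 (Fin n)) → SimpleGraph (Fin n)

/-- The probability, over the seed of the sketch, that the graph recovered from the sketch of `G`
and the deletion set `F` is a `t`-spanner of `G - F`. -/
noncomputable def RandomizedSketch.successProb {n s : ℕ} (S : RandomizedSketch n s) (t : ℝ)
    (G : SimpleGraph (Fin n)) (F : Finset (Sym2 (Fin n))) : ℝ :=
  (S.seedDist.toOuterMeasure
    {ω | IsSpanner t (G.deleteEdges (F : Set (Sym2 (Fin n)))) (S.recover (S.sketch G ω) F)}).toReal

end ObliviousSpanner

/-! The sketch is built in about `log n` levels. At the level `i`, the graph has at most `n d` darts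
(ordered pairs of adjacent vertices), where `d = D * 2 ^ i` and `D` is of order `√f log² n`. With
the weights `w(v) = deg v + d`, the vertices are partitioned so that every set `U` in a class `P`
has a boundary inside `P` of order `φ w(U) log (w(P) / w(U))`, with `φ` of order `1 / log n`, while
at most half of the darts join different classes (`exists_expander_decomposition`). These go to the
next lower level; at level `0` the graph has at most `n D` darts and is stored explicitly.

For the edges inside the classes, two things are stored.

* A sample of the darts at rate `2 ^ (-i)`, which has about `n D` elements. Deleting `f` edges does
  not matter to a set `U` of at least `D` vertices, since its boundary has order at least
  `φ D d ≥ f`. A union bound over pairs `(U, W)` of vertex sets, in which `W` stands for the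
  neighbours that the sample finds, shows that all these sets expand in the surviving part of the
  sample (`prob_exists_unsampled_le`); the number of darts that have to be missed is proportional to
  `(#U + #W) d`, which beats the number of pairs.
* For every vertex, deterministic sparse recovery codes (`exists_sparse_recovery`) of random subsets
  of its neighbourhood, at all dyadic rates. Given the deletions, these yield all surviving
  neighbours if there are at most `32 D` of them, and at least `D` of them otherwise
  (`prob_no_scale_le`).

So an edge that is not recovered explicitly has at both ends at least `D` recovered neighbours, and
from there on the balls around both ends grow in the sample. By the logarithmic factor in the
expansion, `log (w(P) / w(ball))` decays by a factor `1 - φ / 16` in each step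
(`exists_half_lt`), so that after `O(log n * log log n)` steps both balls make up more than half of
the class, and they meet (`stretchAtMost_of_expansion`).

Obliviousness is used in that the sets that the random samples have to hit are determined by the
graph and the deletions, independently of the seed. The recovery procedure does not know the seed; the values of the seed it needs, one for each
vertex, are part of the sketch. -/

namespace ObliviousSpanner

/-! ### Uniform probability on a finite set of seeds -/

open Classical in
/-- The probability of an event under the uniform distribution on a finite type. -/
noncomputable def prob {Ω : Type*} [Fintype Ω] (E : Ω → Prop) : ℝ :=
  (Finset.univ.filter E).card / Fintype.card Ω

section Prob

variable {Ω : Type*} [Fintype Ω]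

lemma prob_mono {E E' : Ω → Prop} (h : ∀ ω, E ω → E' ω) : prob E ≤ prob E' := by
  unfold prob
  gcongr with ω
  exact fun hω => h ω hω

lemma prob_or_le (E E' : Ω → Prop) : prob (fun ω => E ω ∨ E' ω) ≤ prob E + prob E' := by
  classical
  unfold prob
  rw [← add_div]
  gcongr
  norm_cast
  refine (Finset.card_le_card fun ω => ?_).trans (Finset.card_union_le _ _)
  simp

lemma prob_exists_le {κ : Type*} [Fintype κ] (E : κ → Ω → Prop) :
    prob (fun ω => ∃ i, E i ω) ≤ ∑ i, prob (E i) := by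
  classical
  unfold prob
  rw [← Finset.sum_div]
  gcongr
  norm_cast
  refine (Finset.card_le_card fun ω => ?_).trans Finset.card_biUnion_le
  simp

lemma prob_eq_zero {E : Ω → Prop} (h : ∀ ω, ¬ E ω) : prob E = 0 := by
  classical
  unfold prob
  rw [Finset.filter_false_of_mem (fun ω _ => h ω)]
  simp

lemma prob_not_add [Nonempty Ω] (E : Ω → Prop) : prob E + prob (fun ω => ¬ E ω) = 1 := by
  classical
  unfold prob
  rw [← add_div, div_eq_one_iff_eq (by exact_mod_cast Fintype.card_ne_zero)]
  have := Finset.card_filter_add_card_filter_not (s := (Finset.univ : Finset Ω)) E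
  rw [Finset.card_univ] at this
  convert congrArg (Nat.cast : ℕ → ℝ) this using 1
  push_cast
  congr!

/-- Markov's inequality. -/
lemma prob_mul_le [Nonempty Ω] {E : Ω → Prop} {g : Ω → ℝ} {b : ℝ} (hg : ∀ ω, 0 ≤ g ω)
    (hE : ∀ ω, E ω → b ≤ g ω) : prob E * b ≤ (∑ ω, g ω) / Fintype.card Ω := by
  classical
  unfold prob
  rw [div_mul_eq_mul_div]
  gcongr
  calc ((Finset.univ.filter E).card : ℝ) * b = ∑ _ω ∈ Finset.univ.filter E, b := by simp
    _ ≤ ∑ ω ∈ Finset.univ.filter E, g ω :=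
        Finset.sum_le_sum fun ω h => hE ω (Finset.mem_filter.1 h).2
    _ ≤ ∑ ω, g ω := Finset.sum_le_sum_of_subset_of_nonneg (Finset.filter_subset _ _)
        fun ω _ _ => hg ω

end Prob

/-! ### Random sampling of a finite set -/

section Sampling

variable {ι : Type*} {Q : ℕ}

/-- The elements of `T` sampled by the seed `ω` at rate `a / Q`. -/
def sampled (a : ℕ) (ω : ι → Fin Q) (T : Finset ι) : Finset ι :=
  T.filter fun i => (ω i : ℕ) < a

lemma mem_sampled {a : ℕ} {ω : ι → Fin Q} {T : Finset ι} {i : ι} :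
    i ∈ sampled a ω T ↔ i ∈ T ∧ (ω i : ℕ) < a := by
  simp [sampled]

variable [Fintype ι] [DecidableEq ι]

/-- The generating function of the number of sampled elements. All tail bounds come from it, at
`z = 0`, `z = 1/2` and `z = 2`. -/
lemma sum_pow_sampled [NeZero Q] {a : ℕ} (ha : a ≤ Q) (T : Finset ι) (z : ℝ) :
    (∑ ω : ι → Fin Q, z ^ (sampled a ω T).card) / Fintype.card (ι → Fin Q)
      = (1 + (a / Q : ℝ) * (z - 1)) ^ T.card := by
  have hQ : (Q : ℝ) ≠ 0 := by exact_mod_cast NeZero.ne Q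
  have hcard : (Finset.univ.filter fun x : Fin Q => (x : ℕ) < a).card = a := by
    simpa [ha] using Fin.card_filter_val_lt (n := Q) (m := a)
  have hone : ∀ i : ι, (∑ x : Fin Q, (if i ∈ T ∧ (x : ℕ) < a then z else 1))
      = Q * (if i ∈ T then 1 + (a / Q : ℝ) * (z - 1) else 1) := by
    intro i
    by_cases hi : i ∈ T
    · have h0 : ∀ x : Fin Q, (if (x : ℕ) < a then z else 1)
          = 1 + (if (x : ℕ) < a then z - 1 else 0) := by
        intro x; split_ifs <;> ring
      simp only [hi, true_and, if_true, h0, Finset.sum_add_distrib]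
      rw [← Finset.sum_filter, Finset.sum_const, Finset.sum_const, hcard, Finset.card_univ,
        Fintype.card_fin, nsmul_eq_mul, nsmul_eq_mul]
      field_simp
    · simp [hi]
  have hpow : ∀ ω : ι → Fin Q, z ^ (sampled a ω T).card
      = ∏ i, (if i ∈ T ∧ (ω i : ℕ) < a then z else 1) := by
    intro ω
    rw [← Finset.prod_filter, Finset.prod_const]
    congr 2
    ext i; simp [mem_sampled]
  simp_rw [hpow]
  rw [← Fintype.piFinset_univ, ← Finset.prod_univ_sum (fun _ : ι => (Finset.univ : Finset (Fin Q)))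
    (fun i x => if i ∈ T ∧ (x : ℕ) < a then z else 1)]
  simp_rw [hone]
  rw [Finset.prod_mul_distrib, ← Finset.prod_filter]
  simp [hQ]

variable [NeZero Q] {a : ℕ}

lemma prob_sampled_empty_le (ha : a ≤ Q) (T : Finset ι) :
    prob (fun ω : ι → Fin Q => sampled a ω T = ∅) ≤ Real.exp (-(a / Q * T.card)) := by
  have h := prob_mul_le (Ω := ι → Fin Q) (E := fun ω => sampled a ω T = ∅)
    (g := fun ω => (0 : ℝ) ^ (sampled a ω T).card) (b := 1) (fun ω => by positivity)
    (fun ω h => by simp [h])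
  rw [sum_pow_sampled ha, mul_one] at h
  refine h.trans ?_
  have hp : (a / Q : ℝ) ≤ 1 := div_le_one_of_le₀ (by exact_mod_cast ha) (by positivity)
  calc (1 + (a / Q : ℝ) * (0 - 1)) ^ T.card ≤ (Real.exp (-(a / Q))) ^ T.card := by
        gcongr
        · linarith
        · linarith [Real.add_one_le_exp (-(a / Q : ℝ))]
    _ = _ := by rw [← Real.exp_nat_mul]; ring_nf

lemma prob_le_card_sampled_le (ha : a ≤ Q) (T : Finset ι) (k : ℕ) :
    prob (fun ω : ι → Fin Q => k ≤ (sampled a ω T).card)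
      ≤ Real.exp (a / Q * T.card) / 2 ^ k := by
  have h := prob_mul_le (Ω := ι → Fin Q) (E := fun ω => k ≤ (sampled a ω T).card)
    (g := fun ω => (2 : ℝ) ^ (sampled a ω T).card) (b := 2 ^ k) (fun ω => by positivity)
    (fun ω h => pow_le_pow_right₀ (by norm_num) h)
  rw [sum_pow_sampled ha] at h
  rw [le_div_iff₀ (by positivity)]
  refine h.trans ?_
  calc (1 + (a / Q : ℝ) * (2 - 1)) ^ T.card ≤ (Real.exp (a / Q)) ^ T.card := by
        gcongr
        linarith [Real.add_one_le_exp (a / Q : ℝ)]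
    _ = _ := by rw [← Real.exp_nat_mul]; ring_nf

lemma prob_card_sampled_le_le (ha : a ≤ Q) (T : Finset ι) (k : ℕ) :
    prob (fun ω : ι → Fin Q => (sampled a ω T).card ≤ k)
      ≤ 2 ^ k * Real.exp (-(a / Q * T.card / 2)) := by
  have h := prob_mul_le (Ω := ι → Fin Q) (E := fun ω => (sampled a ω T).card ≤ k)
    (g := fun ω => (1 / 2 : ℝ) ^ (sampled a ω T).card) (b := (1 / 2) ^ k) (fun ω => by positivity)
    (fun ω h => pow_le_pow_of_le_one (by norm_num) (by norm_num) h)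
  rw [sum_pow_sampled ha] at h
  have hp : (a / Q : ℝ) ≤ 1 := div_le_one_of_le₀ (by exact_mod_cast ha) (by positivity)
  have h2 : (1 + (a / Q : ℝ) * (1 / 2 - 1)) ^ T.card ≤ Real.exp (-(a / Q * T.card / 2)) := by
    calc (1 + (a / Q : ℝ) * (1 / 2 - 1)) ^ T.card ≤ (Real.exp (-(a / Q / 2))) ^ T.card := by
          gcongr
          · linarith
          · linarith [Real.add_one_le_exp (-(a / Q / 2 : ℝ))]
      _ = _ := by rw [← Real.exp_nat_mul]; ring_nf
  have h3 := h.trans h2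
  rw [one_div, inv_pow, ← div_eq_mul_inv, div_le_iff₀ (by positivity)] at h3
  linarith

/-- A union bound over pairs of vertex sets: with high probability, every set `A U W` that is large
compared with `U` and `W` is hit by the sample. -/
lemma prob_exists_unsampled_le {V : Type*} [Fintype V] [DecidableEq V] (ha : a ≤ Q)
    (A : Finset V → Finset V → Finset ι) {M x : ℝ} (hM : Real.exp (-(a / Q * M)) ≤ x)
    (hx : Fintype.card V * x ≤ 1 / 2) :
    prob (fun ω : ι → Fin Q => ∃ U W : Finset V, U.Nonempty ∧
      M * (U.card + W.card) ≤ (A U W).card ∧ sampled a ω (A U W) = ∅)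
      ≤ 4 * (Fintype.card V * x) := by
  classical
  set n := Fintype.card V
  have hx0 : 0 ≤ x := (Real.exp_pos _).le.trans hM
  have hpair : ∀ U W : Finset V, prob (fun ω : ι → Fin Q => U.Nonempty ∧
      M * (U.card + W.card) ≤ (A U W).card ∧ sampled a ω (A U W) = ∅)
      ≤ (x ^ U.card - if U = ∅ then 1 else 0) * x ^ W.card := by
    intro U W
    by_cases hU : U.Nonempty ∧ M * (U.card + W.card) ≤ (A U W).card
    · refine (prob_mono fun ω h => h.2.2).trans ((prob_sampled_empty_le ha _).trans ?_)
      rw [if_neg hU.1.ne_empty, sub_zero, ← pow_add]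
      refine le_trans ?_ (pow_le_pow_left₀ (Real.exp_pos _).le hM _)
      rw [← Real.exp_nat_mul, Real.exp_le_exp]
      have : (a / Q : ℝ) * (M * (U.card + W.card)) ≤ a / Q * (A U W).card := by
        gcongr; exact hU.2
      push_cast
      linarith
    · rw [prob_eq_zero fun ω h => hU ⟨h.1, h.2.1⟩]
      refine mul_nonneg ?_ (by positivity)
      split_ifs with h
      · simp [h]
      · simp only [sub_zero]; positivity
  have hsum : ∑ S : Finset V, x ^ S.card = (x + 1) ^ n := by
    have := Fintype.sum_pow_mul_eq_add_pow V x 1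
    simpa using this
  calc _ ≤ ∑ U : Finset V, ∑ W : Finset V, prob (fun ω : ι → Fin Q => U.Nonempty ∧
      M * (U.card + W.card) ≤ (A U W).card ∧ sampled a ω (A U W) = ∅) :=
        (prob_exists_le _).trans (Finset.sum_le_sum fun U _ => prob_exists_le _)
    _ ≤ ∑ U : Finset V, ∑ W : Finset V, (x ^ U.card - if U = ∅ then 1 else 0) * x ^ W.card :=
        Finset.sum_le_sum fun U _ => Finset.sum_le_sum fun W _ => hpair U W
    _ = ((x + 1) ^ n - 1) * (x + 1) ^ n := by
        rw [← Finset.sum_mul_sum, Finset.sum_sub_distrib, hsum]; simp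
    _ ≤ (2 * (n * x)) * 2 := by
        have h1 : (x + 1) ^ n ≤ Real.exp (n * x) := by
          rw [Real.exp_nat_mul]
          gcongr
          exact Real.add_one_le_exp x
        have h0 : 0 ≤ n * x := by positivity
        have h2 : Real.exp (n * x) ≤ 1 + 2 * (n * x) := by
          have h4 := Real.exp_bound' (x := n * x) h0 (by linarith) (n := 2) (by norm_num)
          norm_num [Finset.sum_range_succ] at h4
          nlinarith
        have h3 : (1 : ℝ) ≤ (x + 1) ^ n := one_le_pow₀ (by linarith)
        gcongr <;> linarith
    _ = 4 * (n * x) := by ring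

end Sampling

/-! ### Deterministic sparse recovery -/

section SparseRecovery

/-- The greedy colouring. -/
lemma exists_coloring_of_degree_lt {α : Type*} [Fintype α] [DecidableEq α] (r : α → α → Prop)
    [DecidableRel r] (hs : ∀ x y, r x y → r y x) (N : ℕ)
    (hN : ∀ x, (Finset.univ.filter (r x)).card < N) :
    ∃ col : α → Fin N, ∀ x y, x ≠ y → r x y → col x ≠ col y := by
  suffices h : ∀ s : Finset α, ∃ col : α → Fin N,
      ∀ x ∈ s, ∀ y ∈ s, x ≠ y → r x y → col x ≠ col y by
    obtain ⟨col, h⟩ := h Finset.univ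
    exact ⟨col, fun x y => h x (Finset.mem_univ _) y (Finset.mem_univ _)⟩
  intro s
  induction s using Finset.induction_on with
  | empty =>
    rcases isEmpty_or_nonempty α with hα | ⟨⟨a⟩⟩
    · exact ⟨fun x => (hα.false x).elim, by simp⟩
    · exact ⟨fun _ => ⟨0, (Nat.zero_le _).trans_lt (hN a)⟩, by simp⟩
  | insert a s ha ih =>
    obtain ⟨col, hcol⟩ := ih
    obtain ⟨b, hb⟩ : ∃ b : Fin N, b ∉ (Finset.univ.filter (r a)).image col := by
      by_contra! hall
      have := Finset.card_le_card (fun b _ => hall b :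
        (Finset.univ : Finset (Fin N)) ⊆ (Finset.univ.filter (r a)).image col)
      rw [Finset.card_univ, Fintype.card_fin] at this
      exact absurd (this.trans Finset.card_image_le) (not_le.2 (hN a))
    have hb' : ∀ y, r a y → col y ≠ b := fun y hy h =>
      hb (Finset.mem_image.2 ⟨y, by simpa using hy, h⟩)
    refine ⟨Function.update col a b, ?_⟩
    intro x hx y hy hxy hr
    by_cases hxa : x = a
    · subst hxa
      rw [Function.update_self, Function.update_of_ne hxy.symm]
      exact (hb' y hr).symm
    · by_cases hya : y = a
      · subst hya
        rw [Function.update_self, Function.update_of_ne hxa]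
        exact hb' x (hs _ _ hr)
      · rw [Function.update_of_ne hxa, Function.update_of_ne hya]
        exact hcol x ((Finset.mem_insert.1 hx).resolve_left hxa) y
          ((Finset.mem_insert.1 hy).resolve_left hya) hxy hr

lemma card_filter_card_le_le (α : Type*) [Fintype α] [DecidableEq α] (m : ℕ) :
    (Finset.univ.filter fun S : Finset α => S.card ≤ m).card ≤ (Fintype.card α + 1) ^ m := by
  -- A set of at most `m` elements is the range of a sequence of length `m` in `Option α`.
  let g : (Fin m → Option α) → Finset α := fun u => Finset.univ.filter fun x => ∃ i, u i = some x
  have hsub : (Finset.univ.filter fun S : Finset α => S.card ≤ m) ⊆ Finset.univ.image g := by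
    intro S hS
    have hS : S.card ≤ m := by simpa using hS
    refine Finset.mem_image.2 ⟨fun i => if h : (i : ℕ) < S.card then
      some (S.equivFin.symm ⟨i, h⟩ : α) else none, Finset.mem_univ _, ?_⟩
    ext x
    simp only [g, Finset.mem_filter, Finset.mem_univ, true_and]
    constructor
    · rintro ⟨i, hi⟩
      split_ifs at hi with h
      rw [← Option.some.inj hi]
      exact Finset.coe_mem _
    · intro hx
      refine ⟨⟨S.equivFin ⟨x, hx⟩, (S.equivFin ⟨x, hx⟩).2.trans_le hS⟩, ?_⟩
      simp
  refine (Finset.card_le_card hsub).trans (Finset.card_image_le.trans ?_)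
  simp [Finset.card_univ]

/-- A code for the subsets of `V`, from which `S` can be recovered by anyone who knows `D ⊆ S` with
`|S \ D| ≤ k`; if `|S \ D| > k`, this is detected, and nothing is recovered. The code consists of
the cardinality of `S` and a colour in a colouring that separates sets whose symmetric difference
has at most `2 k` elements. -/
theorem exists_sparse_recovery (V : Type*) [Fintype V] [DecidableEq V] (k : ℕ) :
    ∃ (code : Finset V → Fin (Fintype.card V + 1) × Fin ((Fintype.card V + 1) ^ (2 * k) + 1))
      (dec : Fin (Fintype.card V + 1) × Fin ((Fintype.card V + 1) ^ (2 * k) + 1) →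
        Finset V → Finset V),
      ∀ S D : Finset V, D ⊆ S → dec (code S) D = if (S \ D).card ≤ k then S \ D else ∅ := by
  classical
  obtain ⟨col, hcol⟩ := exists_coloring_of_degree_lt
    (fun S T : Finset V => (symmDiff S T).card ≤ 2 * k)
    (fun S T (h : (symmDiff S T).card ≤ 2 * k) => show (symmDiff T S).card ≤ 2 * k by
      rwa [symmDiff_comm]) ((Fintype.card V + 1) ^ (2 * k) + 1) (by
      intro S
      refine Nat.lt_succ_of_le (le_trans ?_ (card_filter_card_le_le V (2 * k)))
      refine Finset.card_le_card_of_injOn (fun T => symmDiff S T) (fun T hT => by simpa using hT) ?_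
      intro T _ T' _ h
      exact symmDiff_right_injective S h)
  let code : Finset V → Fin (Fintype.card V + 1) × Fin ((Fintype.card V + 1) ^ (2 * k) + 1) :=
    fun S => (⟨S.card, Nat.lt_succ_of_le (Finset.card_le_univ S)⟩, col S)
  refine ⟨code, fun c D => if h : ∃ S, D ⊆ S ∧ code S = c ∧ (S \ D).card ≤ k then h.choose \ D
    else ∅, ?_⟩
  intro S D hD
  beta_reduce
  by_cases hk : (S \ D).card ≤ k
  · have hex : ∃ T, D ⊆ T ∧ code T = code S ∧ (T \ D).card ≤ k := ⟨S, hD, rfl, hk⟩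
    rw [dif_pos hex, if_pos hk]
    obtain ⟨h1, h2, h3⟩ := hex.choose_spec
    set T := hex.choose
    suffices T = S by rw [this]
    by_contra hne
    refine hcol T S hne ?_ (congrArg Prod.snd h2)
    have hsub : symmDiff T S ⊆ (T \ D) ∪ (S \ D) := by
      intro x hx
      rw [Finset.mem_symmDiff] at hx
      rcases hx with ⟨h, h'⟩ | ⟨h, h'⟩
      · exact Finset.mem_union_left _ (Finset.mem_sdiff.2 ⟨h, fun hd => h' (hD hd)⟩)
      · exact Finset.mem_union_right _ (Finset.mem_sdiff.2 ⟨h, fun hd => h' (h1 hd)⟩)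
    have := (Finset.card_le_card hsub).trans (Finset.card_union_le _ _)
    omega
  · rw [if_neg hk, dif_neg]
    rintro ⟨T, h1, h2, h3⟩
    have hc : T.card = S.card := congrArg (fun c => (c.1 : ℕ)) h2
    rw [Finset.card_sdiff_of_subset h1] at h3
    rw [Finset.card_sdiff_of_subset hD] at hk
    omega

end SparseRecovery

/-! ### Decomposition of a graph into weighted expanders -/

section Decomposition

variable {V : Type*} [Fintype V]

open Classical in
/-- The ordered pairs of adjacent vertices, so that every edge is counted twice. -/
noncomputable def darts (G : SimpleGraph V) : Finset (V × V) :=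
  Finset.univ.filter fun p => G.Adj p.1 p.2

open Classical in
/-- The neighbours of a vertex. -/
noncomputable def nbrs (G : SimpleGraph V) (v : V) : Finset V := Finset.univ.filter (G.Adj v)

open Classical in
/-- The class of the colour `γ` in the partition of the vertices given by `c`. -/
noncomputable def part (c : V → Option V) (γ : Option V) : Finset V :=
  Finset.univ.filter fun v => c v = γ

open Classical in
/-- The darts of `G` that leave `U` inside their class of the partition `c`. -/
noncomputable def boundary (G : SimpleGraph V) (c : V → Option V) (U : Finset V) :
    Finset (V × V) :=
  (darts G).filter fun p => p.1 ∈ U ∧ p.2 ∉ U ∧ c p.1 = c p.2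

open Classical in
/-- The darts of `G` between different classes of the partition `c`. -/
noncomputable def cutDarts (G : SimpleGraph V) (c : V → Option V) : Finset (V × V) :=
  (darts G).filter fun p => c p.1 ≠ c p.2

@[simp] lemma mem_darts {G : SimpleGraph V} {p : V × V} : p ∈ darts G ↔ G.Adj p.1 p.2 := by
  simp [darts]

@[simp] lemma mem_nbrs {G : SimpleGraph V} {v w : V} : w ∈ nbrs G v ↔ G.Adj v w := by
  simp [nbrs]

@[simp] lemma mem_part {c : V → Option V} {γ : Option V} {v : V} : v ∈ part c γ ↔ c v = γ := by
  simp [part]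

lemma mem_boundary {G : SimpleGraph V} {c : V → Option V} {U : Finset V} {p : V × V} :
    p ∈ boundary G c U ↔ G.Adj p.1 p.2 ∧ p.1 ∈ U ∧ p.2 ∉ U ∧ c p.1 = c p.2 := by
  simp [boundary]

lemma mem_cutDarts {G : SimpleGraph V} {c : V → Option V} {p : V × V} :
    p ∈ cutDarts G c ↔ G.Adj p.1 p.2 ∧ c p.1 ≠ c p.2 := by
  simp [cutDarts]

lemma sum_card_nbrs (G : SimpleGraph V) : ∑ v, (nbrs G v).card = (darts G).card := by
  classical
  rw [Finset.card_eq_sum_card_fiberwise (f := Prod.fst) (t := Finset.univ) (by simp)]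
  refine Finset.sum_congr rfl fun v _ => ?_
  refine Finset.card_bij (fun w _ => (v, w)) (by simp) (by simp) ?_
  rintro ⟨a, b⟩ h
  simp only [Finset.mem_filter, mem_darts] at h
  exact ⟨b, by simpa [← h.2] using h.1, by rw [h.2]⟩

/-- Splitting a set `U` off its class cuts only the darts leaving `U`, in both directions. -/
lemma card_cutDarts_split_le (G : SimpleGraph V) (c c' : V → Option V) (U : Finset V)
    (hU : ∀ x ∈ U, ∀ y ∈ U, c' x = c' y) (hc : ∀ x, x ∉ U → c' x = c x) :
    (cutDarts G c').card ≤ (cutDarts G c).card + 2 * (boundary G c U).card := by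
  classical
  have hsub : cutDarts G c' ⊆ cutDarts G c ∪
      (boundary G c U ∪ (boundary G c U).map (Equiv.prodComm V V).toEmbedding) := by
    rintro ⟨x, y⟩ h
    rw [mem_cutDarts] at h
    simp only [Finset.mem_union, mem_cutDarts, Finset.mem_map, mem_boundary]
    by_cases hxy : c x = c y
    · by_cases hx : x ∈ U <;> by_cases hy : y ∈ U
      · exact absurd (hU x hx y hy) h.2
      · exact Or.inr (Or.inl ⟨h.1, hx, hy, hxy⟩)
      · exact Or.inr (Or.inr ⟨(y, x), ⟨h.1.symm, hy, hx, hxy.symm⟩, rfl⟩)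
      · exact absurd (by rw [hc x hx, hc y hy, hxy]) h.2
    · exact Or.inl ⟨h.1, hxy⟩
  refine (Finset.card_le_card hsub).trans ((Finset.card_union_le _ _).trans ?_)
  gcongr
  refine (Finset.card_union_le _ _).trans ?_
  rw [Finset.card_map, two_mul]

/-- Expander decomposition: the classes are expanders in which a set `U` of weight `w(U)` has a
boundary of order `φ w(U) log (w(P) / w(U))`, where `P` is the class of `U`. Small sets thus expand
better, by the logarithmic factor, than in an expander of conductance `φ`. The partition minimizes
the potential `#cut + φ ∑ v, w v * log w(P v)`, where `P v` is the class of `v`: splitting off a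
set that violates the expansion would lower the potential. -/
theorem exists_expander_decomposition (G : SimpleGraph V) (w : V → ℝ) {d φ : ℝ} (hd : 0 < d)
    (hw : ∀ v, d ≤ w v) (hφ : 0 ≤ φ) :
    ∃ c : V → Option V,
      ((cutDarts G c).card : ℝ) ≤ φ * (∑ v, w v) * Real.log ((∑ v, w v) / d) ∧
      ∀ (U : Finset V) (γ : Option V), U.Nonempty → U ⊆ part c γ →
        φ * (∑ v ∈ U, w v) * Real.log ((∑ v ∈ part c γ, w v) / ∑ v ∈ U, w v)
          ≤ 2 * (boundary G c U).card := by
  classical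
  have hw0 : ∀ v, 0 < w v := fun v => hd.trans_le (hw v)
  let pot : (V → Option V) → ℝ := fun c => (cutDarts G c).card
    + φ * ∑ v, w v * Real.log (∑ u ∈ part c (c v), w u)
  obtain ⟨c, hc⟩ := Finite.exists_min pot
  have hpos : ∀ {U : Finset V}, U.Nonempty → 0 < ∑ v ∈ U, w v := fun hU =>
    Finset.sum_pos (fun v _ => hw0 v) hU
  refine ⟨c, ?_, ?_⟩
  · -- comparison with the trivial partition
    rcases isEmpty_or_nonempty V with hV | hV
    · simp [cutDarts, Finset.univ_eq_empty]
    have h := hc (fun _ => none)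
    simp only [pot] at h
    have h1 : cutDarts G (fun _ => (none : Option V)) = ∅ := by
      ext p; simp [mem_cutDarts]
    have h2 : part (fun _ : V => (none : Option V)) none = Finset.univ := by
      ext; simp
    rw [h1, h2, ← Finset.sum_mul] at h
    have h3 : ∑ v, w v * Real.log d ≤ ∑ v, w v * Real.log (∑ u ∈ part c (c v), w u) := by
      refine Finset.sum_le_sum fun v _ => mul_le_mul_of_nonneg_left ?_ (hw0 v).le
      refine Real.log_le_log hd ((hw v).trans ?_)
      exact Finset.single_le_sum (f := w) (fun u _ => (hw0 u).le) (by simp)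
    rw [← Finset.sum_mul] at h3
    have h4 := mul_le_mul_of_nonneg_left h3 hφ
    rw [Real.log_div (hpos Finset.univ_nonempty).ne' hd.ne', mul_sub]
    simp only [Finset.card_empty, Nat.cast_zero, zero_add] at h
    linarith
  · intro U γ hU hUγ
    set P := part c γ
    obtain ⟨b, hb⟩ : ∃ b, b ∉ Set.range c := by
      by_contra! h
      have := Fintype.card_le_of_surjective c (fun b => h b)
      simp at this
    let c' : V → Option V := fun v => if v ∈ U then b else c v
    have hbc : ∀ v, c v ≠ b := fun v h => hb ⟨v, h⟩
    have hpartU : ∀ v ∈ U, part c' (c' v) = U := by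
      intro v hv
      ext x
      by_cases hx : x ∈ U <;> simp [c', hv, hx, hbc]
    have hpart : ∀ v, v ∉ U → part c' (c' v) ⊆ part c (c v) := by
      intro v hv x
      by_cases hx : x ∈ U
      · simp [c', hv, hx, (hbc v).symm]
      · simp [c', hv, hx]
    have hPU : ∀ v ∈ U, part c (c v) = P := fun v hv => by
      rw [show c v = γ from mem_part.1 (hUγ hv)]
    have hcut := card_cutDarts_split_le G c c' U (fun x hx y hy => by simp [c', hx, hy])
      (fun x hx => by simp [c', hx])
    have hsplit : ∑ v, w v * Real.log (∑ u ∈ part c' (c' v), w u)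
        ≤ ∑ v, w v * Real.log (∑ u ∈ part c (c v), w u)
          - (∑ v ∈ U, w v) * Real.log (∑ v ∈ P, w v)
          + (∑ v ∈ U, w v) * Real.log (∑ v ∈ U, w v) := by
      rw [← Finset.sum_add_sum_compl U, ← Finset.sum_add_sum_compl U
        (fun v => w v * Real.log (∑ u ∈ part c (c v), w u))]
      rw [Finset.sum_congr rfl fun v hv => by rw [hpartU v hv], ← Finset.sum_mul,
        Finset.sum_congr (s₁ := U) (f := fun v => w v * Real.log (∑ u ∈ part c (c v), w u)) rfl
          fun v hv => by rw [hPU v hv], ← Finset.sum_mul]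
      have : ∑ v ∈ Uᶜ, w v * Real.log (∑ u ∈ part c' (c' v), w u)
          ≤ ∑ v ∈ Uᶜ, w v * Real.log (∑ u ∈ part c (c v), w u) := by
        refine Finset.sum_le_sum fun v hv => mul_le_mul_of_nonneg_left ?_ (hw0 v).le
        refine Real.log_le_log (hpos ⟨v, by simp⟩) ?_
        exact Finset.sum_le_sum_of_subset_of_nonneg (hpart v (by simpa using hv))
          fun u _ _ => (hw0 u).le
      linarith
    have h := hc c'
    simp only [pot] at h
    have h1 : ((cutDarts G c').card : ℝ) ≤ (cutDarts G c).card + 2 * (boundary G c U).card := by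
      exact_mod_cast hcut
    have h2 := mul_le_mul_of_nonneg_left hsplit hφ
    rw [Real.log_div (hpos (hU.mono hUγ)).ne' (hpos hU).ne']
    linarith

end Decomposition

/-! ### Growth of balls -/

/-- If a quantity `B i` grows by the factor `1 + φ / 8 * log (Ω / B i)` as long as it is at most
`Ω / 2`, then `log (Ω / B i)` decays geometrically, at the rate `1 - φ / 16`. -/
lemma exists_half_lt {B : ℕ → ℝ} {Ω φ X : ℝ} {T : ℕ} (hB : 0 < B 0) (hφ : 0 < φ)
    (hX : Real.log (Ω / B 0) ≤ X) (hφX : φ * X ≤ 8)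
    (hgrow : ∀ i, 2 * B i ≤ Ω → B i * (1 + φ / 8 * Real.log (Ω / B i)) ≤ B (i + 1))
    (hT : X * Real.exp (-(φ / 16 * T)) < Real.log 2) : ∃ i ≤ T, Ω < 2 * B i := by
  by_contra! hcon
  have hlog2 : 0 < Real.log 2 := Real.log_pos (by norm_num)
  have hlb : ∀ i ≤ T, 0 < B i → Real.log 2 ≤ Real.log (Ω / B i) := fun i hi h =>
    Real.log_le_log (by norm_num) ((le_div_iff₀ h).2 (hcon i hi))
  have hX0 : 0 < X := hlog2.trans_le ((hlb 0 (Nat.zero_le _) hB).trans hX)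
  have hφ16 : φ / 16 ≤ 1 := by
    by_contra! h
    have h1 : 1 / 2 ≤ X := by
      have := Real.log_two_gt_d9
      linarith [hlb 0 (Nat.zero_le _) hB]
    nlinarith
  have key : ∀ i ≤ T, 0 < B i ∧ Real.log (Ω / B i) ≤ X * (1 - φ / 16) ^ i := by
    intro i
    induction i with
    | zero => exact fun _ => ⟨hB, by simpa using hX⟩
    | succ i ih =>
      intro hi
      obtain ⟨hBi, hlog⟩ := ih (by omega)
      have hhalf := hcon i (by omega)
      have hΩ : 0 < Ω := by linarith
      have hx := hlb i (by omega) hBi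
      set x := Real.log (Ω / B i)
      set y := φ / 8 * x
      have hy0 : 0 < y := by have := hlog2.trans_le hx; positivity
      have hxX : x ≤ X := hlog.trans
        (mul_le_of_le_one_right hX0.le (pow_le_one₀ (by linarith) (by linarith)))
      have hy1 : y ≤ 1 := by
        have : φ * x ≤ φ * X := by gcongr
        simp only [y]; linarith
      have hg := hgrow i hhalf
      have hBs : 0 < B (i + 1) := lt_of_lt_of_le (by positivity) hg
      refine ⟨hBs, ?_⟩
      have h1 : Real.log (Ω / B (i + 1)) ≤ x - Real.log (1 + y) := by
        have h2 : Real.log (B i * (1 + y)) ≤ Real.log (B (i + 1)) :=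
          Real.log_le_log (by positivity) hg
        rw [Real.log_mul hBi.ne' (by positivity)] at h2
        simp only [x]
        rw [Real.log_div hΩ.ne' hBs.ne', Real.log_div hΩ.ne' hBi.ne']
        linarith
      have h3 : y / 2 ≤ Real.log (1 + y) := by
        refine le_trans ?_ (Real.le_log_one_add_of_nonneg hy0.le)
        rw [div_le_div_iff₀ (by norm_num) (by linarith)]
        nlinarith
      calc Real.log (Ω / B (i + 1)) ≤ x * (1 - φ / 16) := by
            have : y / 2 = x * (φ / 16) := by simp only [y]; ring
            linarith
        _ ≤ X * (1 - φ / 16) ^ i * (1 - φ / 16) := by gcongr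
        _ = X * (1 - φ / 16) ^ (i + 1) := by rw [pow_succ]; ring
  obtain ⟨hBT, h⟩ := key T le_rfl
  have h1 : (1 - φ / 16) ^ T ≤ Real.exp (-(φ / 16 * T)) := by
    rw [show -(φ / 16 * T) = T * (-(φ / 16)) by ring, Real.exp_nat_mul]
    gcongr
    linarith [Real.add_one_le_exp (-(φ / 16))]
  have h2 := mul_le_mul_of_nonneg_left h1 hX0.le
  linarith [hlb T le_rfl hBT]

section Balls

variable {V : Type*} [Fintype V]

open Classical in
/-- The ball of radius `i` around `u` in `H`. -/
noncomputable def ball (H : SimpleGraph V) (u : V) (i : ℕ) : Finset V :=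
  Finset.univ.filter fun v => ∃ p : H.Walk u v, p.length ≤ i

lemma mem_ball {H : SimpleGraph V} {u v : V} {i : ℕ} :
    v ∈ ball H u i ↔ ∃ p : H.Walk u v, p.length ≤ i := by
  simp [ball]

lemma self_mem_ball (H : SimpleGraph V) (u : V) (i : ℕ) : u ∈ ball H u i :=
  mem_ball.2 ⟨.nil, by simp⟩

lemma mem_ball_succ {H : SimpleGraph V} {u x y : V} {i : ℕ} (hx : x ∈ ball H u i)
    (h : H.Adj x y) : y ∈ ball H u (i + 1) := by
  obtain ⟨p, hp⟩ := mem_ball.1 hx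
  exact mem_ball.2 ⟨p.concat h, by simpa using hp⟩

lemma ball_mono (H : SimpleGraph V) (u : V) {i j : ℕ} (hij : i ≤ j) :
    ball H u i ⊆ ball H u j := fun v hv => by
  obtain ⟨p, hp⟩ := mem_ball.1 hv
  exact mem_ball.2 ⟨p, hp.trans hij⟩

lemma ball_subset_part {H : SimpleGraph V} {c : V → Option V}
    (hc : ∀ x y, H.Adj x y → c x = c y) (u : V) (i : ℕ) : ball H u i ⊆ part c (c u) := by
  intro v hv
  obtain ⟨p, -⟩ := mem_ball.1 hv
  rw [mem_part]
  clear hv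
  induction p with
  | nil => rfl
  | cons h p ih => exact ih.trans (hc _ _ h).symm

open Classical in
/-- The vertices outside `U` with a neighbour in `U`. -/
noncomputable def outerNbrs (H : SimpleGraph V) (U : Finset V) : Finset V :=
  Finset.univ.filter fun y => y ∉ U ∧ ∃ x ∈ U, H.Adj x y

lemma mem_outerNbrs {H : SimpleGraph V} {U : Finset V} {y : V} :
    y ∈ outerNbrs H U ↔ y ∉ U ∧ ∃ x ∈ U, H.Adj x y := by
  simp [outerNbrs]

/-- If every set of at least `D` vertices that makes up at most half of its class expands, then a
ball that starts with `D` vertices soon makes up more than half of its class. -/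
lemma exists_ball_half_lt {H : SimpleGraph V} {c : V → Option V} {w : V → ℝ} {φ X : ℝ} {T D : ℕ}
    (hc : ∀ x y, H.Adj x y → c x = c y) (hw : ∀ v, 0 < w v) (hφ : 0 < φ)
    (hX : ∀ (v : V), Real.log ((∑ x ∈ part c (c v), w x) / w v) ≤ X) (hφX : φ * X ≤ 8)
    (hexp : ∀ (U : Finset V) (γ : Option V), U.Nonempty → U ⊆ part c γ → D ≤ U.card →
      2 * ∑ v ∈ U, w v ≤ ∑ v ∈ part c γ, w v →
      φ / 8 * Real.log ((∑ v ∈ part c γ, w v) / ∑ v ∈ U, w v) * ∑ v ∈ U, w v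
        ≤ ∑ v ∈ outerNbrs H U, w v)
    (hT : X * Real.exp (-(φ / 16 * T)) < Real.log 2) {u : V} (hu : D ≤ (nbrs H u).card) :
    ∃ i ≤ T, ∑ v ∈ part c (c u), w v < 2 * ∑ v ∈ ball H u (i + 1), w v := by
  classical
  refine exists_half_lt (B := fun i => ∑ v ∈ ball H u (i + 1), w v) (X := X) ?_ hφ ?_ hφX ?_ hT
  · exact Finset.sum_pos (fun v _ => hw v) ⟨u, self_mem_ball _ _ _⟩
  · refine le_trans (Real.log_le_log ?_ ?_) (hX u)
    · exact div_pos (Finset.sum_pos (fun v _ => hw v) ⟨u, by simp⟩)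
        (Finset.sum_pos (fun v _ => hw v) ⟨u, self_mem_ball _ _ _⟩)
    · refine div_le_div_of_nonneg_left (Finset.sum_nonneg fun v _ => (hw v).le) (hw u) ?_
      exact Finset.single_le_sum (f := w) (fun v _ => (hw v).le) (self_mem_ball _ _ _)
  · intro i hi
    have h := hexp (ball H u (i + 1)) (c u) ⟨u, self_mem_ball _ _ _⟩ (ball_subset_part hc u _)
      (hu.trans (Finset.card_le_card fun v hv => ball_mono H u (by omega : 0 + 1 ≤ i + 1)
        (mem_ball_succ (self_mem_ball H u 0) (mem_nbrs.1 hv)))) hi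
    have hdisj : Disjoint (ball H u (i + 1)) (outerNbrs H (ball H u (i + 1))) :=
      Finset.disjoint_left.2 fun v hv hv' => (mem_outerNbrs.1 hv').1 hv
    have hsub : ball H u (i + 1) ∪ outerNbrs H (ball H u (i + 1)) ⊆ ball H u (i + 1 + 1) := by
      intro v hv
      rcases Finset.mem_union.1 hv with hv | hv
      · exact ball_mono H u (Nat.le_succ _) hv
      · obtain ⟨-, x, hx, hxv⟩ := mem_outerNbrs.1 hv
        exact mem_ball_succ hx hxv
    have h2 := Finset.sum_le_sum_of_subset_of_nonneg (f := w) hsub fun v _ _ => (hw v).le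
    rw [Finset.sum_union hdisj] at h2
    linarith

/-- Two balls that make up more than half of the same class meet. -/
lemma exists_walk_of_half_lt {H : SimpleGraph V} {c : V → Option V} {w : V → ℝ}
    (hc : ∀ x y, H.Adj x y → c x = c y) (hw : ∀ v, 0 < w v) {u v : V} (huv : c u = c v)
    {i j : ℕ} (hi : ∑ x ∈ part c (c u), w x < 2 * ∑ x ∈ ball H u i, w x)
    (hj : ∑ x ∈ part c (c v), w x < 2 * ∑ x ∈ ball H v j, w x) :
    ∃ p : H.Walk u v, p.length ≤ i + j := by
  classical
  by_cases hd : Disjoint (ball H u i) (ball H v j)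
  · exfalso
    have hsub : ball H u i ∪ ball H v j ⊆ part c (c u) :=
      Finset.union_subset (ball_subset_part hc u i) (huv ▸ ball_subset_part hc v j)
    have h := Finset.sum_le_sum_of_subset_of_nonneg (f := w) hsub fun v _ _ => (hw v).le
    rw [Finset.sum_union hd] at h
    rw [← huv] at hj
    linarith
  · obtain ⟨x, hx, hx'⟩ := Finset.not_disjoint_iff.1 hd
    obtain ⟨p, hp⟩ := mem_ball.1 hx
    obtain ⟨q, hq⟩ := mem_ball.1 hx'
    exact ⟨p.append q.reverse, by simpa using add_le_add hp hq⟩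

end Balls

/-! ### Spanners from expanding samples -/

/-- `H` is a subgraph of `G` in which the ends of every edge of `G` are joined by a walk of length
at most `τ`. -/
def StretchAtMost {V : Type*} (τ : ℕ) (G H : SimpleGraph V) : Prop :=
  H ≤ G ∧ ∀ u v, G.Adj u v → ∃ p : H.Walk u v, p.length ≤ τ

lemma StretchAtMost.exists_walk {V : Type*} {τ : ℕ} {G H : SimpleGraph V}
    (h : StretchAtMost τ G H) {u v : V} (p : G.Walk u v) :
    ∃ q : H.Walk u v, q.length ≤ τ * p.length := by
  induction p with
  | nil => exact ⟨.nil, by simp⟩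
  | cons huv p ih =>
    obtain ⟨q, hq⟩ := ih
    obtain ⟨r, hr⟩ := h.2 _ _ huv
    refine ⟨r.append q, ?_⟩
    rw [SimpleGraph.Walk.length_append, SimpleGraph.Walk.length_cons]
    linarith

lemma StretchAtMost.isSpanner {V : Type*} {τ : ℕ} {G H : SimpleGraph V}
    (h : StretchAtMost τ G H) {t : ℝ} (ht : τ ≤ t) : IsSpanner t G H := by
  refine ⟨h.1, fun u v huv => ?_⟩
  obtain ⟨p, hp⟩ := huv.exists_walk_length_eq_dist
  obtain ⟨q, hq⟩ := h.exists_walk p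
  refine ⟨q.reachable, ?_⟩
  have h1 : (H.dist u v : ℝ) ≤ τ * G.dist u v := by
    rw [← hp]
    exact_mod_cast (SimpleGraph.dist_le q).trans hq
  exact h1.trans (by gcongr)

section Level

variable {V : Type*}

/-- The edges of `G` inside the classes of the partition `c`. -/
def inner (G : SimpleGraph V) (c : V → Option V) : SimpleGraph V where
  Adj x y := G.Adj x y ∧ c x = c y
  symm := ⟨fun _ _ h => ⟨h.1.symm, h.2.symm⟩⟩
  loopless := ⟨fun _ h => h.1.ne rfl⟩

/-- The edges of `G` between different classes of the partition `c`. -/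
def outer (G : SimpleGraph V) (c : V → Option V) : SimpleGraph V where
  Adj x y := G.Adj x y ∧ c x ≠ c y
  symm := ⟨fun _ _ h => ⟨h.1.symm, h.2.symm⟩⟩
  loopless := ⟨fun _ h => h.1.ne rfl⟩

variable [Fintype V]

open Classical in
/-- The darts that leave `U` inside their class, avoid `W`, and survive the deletion of `F`. -/
noncomputable def freeDarts (G : SimpleGraph V) (c : V → Option V) (F : Finset (Sym2 V))
    (U W : Finset V) : Finset (V × V) :=
  (boundary G c U).filter fun p => p.2 ∉ W ∧ s(p.1, p.2) ∉ F

lemma mem_freeDarts {G : SimpleGraph V} {c : V → Option V} {F : Finset (Sym2 V)}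
    {U W : Finset V} {p : V × V} : p ∈ freeDarts G c F U W ↔
      (G.Adj p.1 p.2 ∧ p.1 ∈ U ∧ p.2 ∉ U ∧ c p.1 = c p.2) ∧ p.2 ∉ W ∧ s(p.1, p.2) ∉ F := by
  simp [freeDarts, mem_boundary]

lemma card_boundary_le (G : SimpleGraph V) (c : V → Option V) (F : Finset (Sym2 V))
    (U W : Finset V) :
    (boundary G c U).card
      ≤ (freeDarts G c F U W).card + ∑ y ∈ W, (nbrs G y).card + F.card := by
  classical
  have hsub : boundary G c U ⊆ (freeDarts G c F U W ∪
      W.biUnion fun y => (nbrs G y).map ⟨fun x => (x, y), fun _ _ h => congrArg Prod.fst h⟩) ∪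
      (boundary G c U).filter fun p => s(p.1, p.2) ∈ F := by
    rintro ⟨x, y⟩ hp
    have hp' := mem_boundary.1 hp
    simp only [Finset.mem_union, mem_freeDarts, Finset.mem_biUnion, Finset.mem_map,
      Finset.mem_filter]
    by_cases hF : s(x, y) ∈ F
    · exact Or.inr ⟨hp, hF⟩
    · by_cases hW : y ∈ W
      · exact Or.inl (Or.inr ⟨y, hW, x, mem_nbrs.2 hp'.1.symm, rfl⟩)
      · exact Or.inl (Or.inl ⟨hp', hW, hF⟩)
  refine (Finset.card_le_card hsub).trans ((Finset.card_union_le _ _).trans ?_)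
  refine add_le_add ((Finset.card_union_le _ _).trans (Nat.add_le_add_left ?_ _)) ?_
  · refine Finset.card_biUnion_le.trans (Finset.sum_le_sum fun y _ => ?_)
    rw [Finset.card_map]
  · refine Finset.card_le_card_of_injOn (fun p => s(p.1, p.2)) (fun p hp => ?_) ?_
    · simpa using (Finset.mem_filter.1 hp).2
    · rintro ⟨x, y⟩ hp ⟨x', y'⟩ hp' h
      have h1 := mem_boundary.1 (Finset.mem_filter.1 hp).1
      have h2 := mem_boundary.1 (Finset.mem_filter.1 hp').1
      -- the orientation is determined by `U`
      rcases Sym2.eq_iff.1 h with ⟨rfl, rfl⟩ | ⟨rfl, rfl⟩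
      · rfl
      · exact absurd h1.2.1 h2.2.2.1

/-- The arithmetic of one growth step: `bd` darts leave a set of weight `wU`, and all but `fr` of
them are deleted (at most `k` of them) or lead to neighbours of total weight `wW`. -/
lemma outer_weight_le {φ d x wU wW bd fr s k cU cW : ℝ} (hφ : 0 < φ) (hφ16 : φ ≤ 16)
    (hwU : 0 < wU) (hwW : 0 ≤ wW) (hx : 1 / 2 ≤ x) (he : φ * wU * x ≤ 2 * bd)
    (hb : bd ≤ fr + s + k) (hW : s ≤ wW) (hfr : fr < φ / 16 * d * (cU + cW))
    (hU : cU * d ≤ wU) (hW' : cW * d ≤ wW) (hk : k ≤ φ / 16 * wU) :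
    φ / 8 * x * wU ≤ wW := by
  have h1 : φ / 16 * d * (cU + cW) ≤ φ / 16 * wU + φ / 16 * wW := by
    have : φ / 16 * (cU * d + cW * d) ≤ φ / 16 * (wU + wW) := by gcongr
    linarith
  have h3 : φ / 16 * wW ≤ wW := mul_le_of_le_one_left hwW (by linarith)
  have h4 : φ * wU * (1 / 2) ≤ φ * wU * x := by gcongr
  have h5 : φ / 8 * x * wU = φ * wU * x / 8 := by ring
  have h6 : φ / 16 * wU = φ * wU / 16 := by ring
  linarith

/-- The deterministic core of the construction. The classes of `c` are expanders for the weights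
`deg v + d`, and `H` contains a dart of each set of surviving darts that is large enough. Then sets
of at least `D` vertices expand in `H`: the weight `D d` of such a set outweighs the number of
deleted edges. As the vertices that do not have all their surviving edges in `H` have at least `D`
neighbours in `H`, the balls around them grow to more than half of their class. -/
theorem stretchAtMost_of_expansion {G H : SimpleGraph V} {c : V → Option V}
    {F : Finset (Sym2 V)} {φ d X : ℝ} {T D : ℕ} (hd : 0 < d) (hφ : 0 < φ) (hφ16 : φ ≤ 16)
    (hG : ((darts G).card : ℝ) ≤ Fintype.card V * d)
    (hX : Real.log (2 * Fintype.card V) ≤ X) (hφX : φ * X ≤ 8)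
    (hT : X * Real.exp (-(φ / 16 * T)) < Real.log 2)
    (hexp : ∀ (U : Finset V) (γ : Option V), U.Nonempty → U ⊆ part c γ →
      φ * (∑ v ∈ U, ((nbrs G v).card + d : ℝ)) *
        Real.log ((∑ v ∈ part c γ, ((nbrs G v).card + d : ℝ)) /
          ∑ v ∈ U, ((nbrs G v).card + d : ℝ)) ≤ 2 * (boundary G c U).card)
    (hF : (F.card : ℝ) ≤ φ / 16 * (D * d))
    (hH : H ≤ (inner G c).deleteEdges (F : Set (Sym2 V)))
    (hhit : ∀ U W : Finset V, U.Nonempty →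
      φ / 16 * d * (U.card + W.card) ≤ (freeDarts G c F U W).card →
      ∃ p ∈ freeDarts G c F U W, H.Adj p.1 p.2)
    (hnbr : ∀ v, (∀ y, ((inner G c).deleteEdges (F : Set (Sym2 V))).Adj v y → H.Adj v y) ∨
      D ≤ (nbrs H v).card) :
    StretchAtMost (2 * (T + 1)) ((inner G c).deleteEdges (F : Set (Sym2 V))) H := by
  classical
  set w : V → ℝ := fun v => (nbrs G v).card + d with hw_def
  have hdw : ∀ v, d ≤ w v := fun v => by simp [w]
  have hw : ∀ v, 0 < w v := fun v => hd.trans_le (hdw v)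
  have hc : ∀ x y, H.Adj x y → c x = c y := fun x y h =>
    ((SimpleGraph.deleteEdges_adj.1 (hH h)).1).2
  have hcard : ∀ S : Finset V, S.card * d ≤ ∑ v ∈ S, w v := fun S => by
    have := Finset.card_nsmul_le_sum S w d fun v _ => hdw v
    rwa [nsmul_eq_mul] at this
  have htot : ∑ v, w v ≤ 2 * Fintype.card V * d := by
    have h1 : (∑ v, ((nbrs G v).card : ℝ)) = (darts G).card := by
      exact_mod_cast sum_card_nbrs G
    simp only [w, Finset.sum_add_distrib, h1, Finset.sum_const, Finset.card_univ, nsmul_eq_mul]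
    linarith
  have hXv : ∀ v : V, Real.log ((∑ x ∈ part c (c v), w x) / w v) ≤ X := by
    intro v
    refine le_trans (Real.log_le_log ?_ ?_) hX
    · exact div_pos (Finset.sum_pos (fun v _ => hw v) ⟨v, by simp⟩) (hw v)
    · rw [div_le_iff₀ (hw v)]
      calc ∑ x ∈ part c (c v), w x ≤ ∑ x, w x :=
            Finset.sum_le_sum_of_subset_of_nonneg (Finset.subset_univ _) fun v _ _ => (hw v).le
        _ ≤ 2 * Fintype.card V * d := htot
        _ ≤ _ := by gcongr; exact hdw v
  have hexpH : ∀ (U : Finset V) (γ : Option V), U.Nonempty → U ⊆ part c γ → D ≤ U.card →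
      2 * ∑ v ∈ U, w v ≤ ∑ v ∈ part c γ, w v →
      φ / 8 * Real.log ((∑ v ∈ part c γ, w v) / ∑ v ∈ U, w v) * ∑ v ∈ U, w v
        ≤ ∑ v ∈ outerNbrs H U, w v := by
    intro U γ hU hUγ hDU hhalf
    set W := outerNbrs H U
    have hA : ((freeDarts G c F U W).card : ℝ) < φ / 16 * d * (U.card + W.card) := by
      by_contra! h
      obtain ⟨p, hp, hadj⟩ := hhit U W hU h
      obtain ⟨h1, h2, -⟩ := mem_freeDarts.1 hp
      exact h2 (mem_outerNbrs.2 ⟨h1.2.2.1, p.1, h1.2.1, hadj⟩)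
    have hb : ((boundary G c U).card : ℝ) ≤ (freeDarts G c F U W).card
        + ∑ y ∈ W, ((nbrs G y).card : ℝ) + F.card := by
      exact_mod_cast card_boundary_le G c F U W
    have hW : ∑ y ∈ W, ((nbrs G y).card : ℝ) ≤ ∑ y ∈ W, w y :=
      Finset.sum_le_sum fun y _ => le_add_of_nonneg_right hd.le
    have hwU : 0 < ∑ v ∈ U, w v := Finset.sum_pos (fun v _ => hw v) hU
    have hx : 1 / 2 ≤ Real.log ((∑ v ∈ part c γ, w v) / ∑ v ∈ U, w v) := by
      have h1 := Real.log_le_log (by norm_num) ((le_div_iff₀ hwU).2 hhalf)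
      linarith [Real.log_two_gt_d9]
    exact outer_weight_le hφ hφ16 hwU (Finset.sum_nonneg fun v _ => (hw v).le) hx
      (hexp U γ hU hUγ) hb hW hA (hcard U) (hcard W)
      (hF.trans (by gcongr; exact le_trans (by gcongr) (hcard U)))
  refine ⟨hH, fun u v huv => ?_⟩
  rcases hnbr u with hu | hu
  · exact ⟨(hu v huv).toWalk, by simp; omega⟩
  rcases hnbr v with hv | hv
  · exact ⟨(hv u huv.symm).symm.toWalk, by simp; omega⟩
  obtain ⟨i, hi, hi'⟩ := exists_ball_half_lt hc hw hφ hXv hφX hexpH hT hu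
  obtain ⟨j, hj, hj'⟩ := exists_ball_half_lt hc hw hφ hXv hφX hexpH hT hv
  obtain ⟨p, hp⟩ := exists_walk_of_half_lt hc hw
    (SimpleGraph.deleteEdges_adj.1 huv).1.2 hi' hj'
  exact ⟨p, by omega⟩

end Level

/-! ### The sketch of the edges inside the classes -/

/-- The embedding of the vertices as the diagonal pairs. -/
def diagEmb (V : Type*) : V ↪ V × V := ⟨fun x => (x, x), fun _ _ h => congrArg Prod.fst h⟩

lemma card_sampled_diag {V : Type*} {Q : ℕ} (a : ℕ) (ω : V × V → Fin Q) (T : Finset V) :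
    (sampled a ω (T.map (diagEmb V))).card = (T.filter fun z => (ω (z, z) : ℕ) < a).card := by
  rw [sampled, Finset.filter_map, Finset.card_map]
  rfl

section LevelSketch

variable {V : Type*} [Fintype V]

/-- The codes of sets of vertices for sparse recovery with sparsity `k`. -/
abbrev SetCode (V : Type*) [Fintype V] (k : ℕ) : Type :=
  Fin (Fintype.card V + 1) × Fin ((Fintype.card V + 1) ^ (2 * k) + 1)

/-- The sketch of the edges inside the classes of a partition. It consists of the partition, of a
hash value for each vertex, of a set of at most `B` sampled darts, and of the codes, for each vertex
and each scale `j ≤ l`, of the set of those neighbours whose hash value is less than `2 ^ (l - j)`.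
The recovery procedure needs the hash values to tell which deleted edges contribute to the code at
a given scale. -/
abbrev LevelMessage (V : Type*) [Fintype V] (l k B : ℕ) : Type _ :=
  (V → Option V) × (V → Fin (2 ^ l)) × {R : Finset (V × V) // R.card ≤ B} ×
    (V → Fin (l + 1) → SetCode V k)

variable {l k B : ℕ}

open Classical in
/-- The neighbours of `v` in its class that are sampled at scale `j`. -/
noncomputable def scaleNbrs (G : SimpleGraph V) (c : V → Option V) (h : V → Fin (2 ^ l)) (v : V)
    (j : ℕ) : Finset V :=
  Finset.univ.filter fun y => (G.Adj v y ∧ c v = c y) ∧ (h y : ℕ) < 2 ^ (l - j)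

open Classical in
/-- The deleted neighbours of `v` in its class that are sampled at scale `j`. -/
noncomputable def scaleDeleted (F : Finset (Sym2 V)) (c : V → Option V) (h : V → Fin (2 ^ l))
    (v : V) (j : ℕ) : Finset V :=
  Finset.univ.filter fun y => (s(v, y) ∈ F ∧ c v = c y) ∧ (h y : ℕ) < 2 ^ (l - j)

/-- The surviving neighbours of `v` in its class. -/
noncomputable abbrev survivors (G : SimpleGraph V) (c : V → Option V) (F : Finset (Sym2 V))
    (v : V) : Finset V :=
  nbrs ((inner G c).deleteEdges (F : Set (Sym2 V))) v

lemma scaleDeleted_subset {G : SimpleGraph V} {F : Finset (Sym2 V)}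
    (hF : (F : Set (Sym2 V)) ⊆ G.edgeSet) (c : V → Option V) (h : V → Fin (2 ^ l)) (v : V)
    (j : ℕ) : scaleDeleted F c h v j ⊆ scaleNbrs G c h v j := by
  intro y hy
  simp only [scaleDeleted, scaleNbrs, Finset.mem_filter, Finset.mem_univ, true_and] at hy ⊢
  exact ⟨⟨hF hy.1.1, hy.1.2⟩, hy.2⟩

lemma scaleNbrs_sdiff [DecidableEq V] (G : SimpleGraph V) (F : Finset (Sym2 V))
    (c : V → Option V) (h : V → Fin (2 ^ l)) (v : V) (j : ℕ) :
    scaleNbrs G c h v j \ scaleDeleted F c h v j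
      = (survivors G c F v).filter fun y => (h y : ℕ) < 2 ^ (l - j) := by
  ext y
  simp only [scaleDeleted, scaleNbrs, Finset.mem_sdiff, Finset.mem_filter, Finset.mem_univ,
    true_and, mem_nbrs, SimpleGraph.deleteEdges_adj, inner, Finset.mem_coe]
  tauto

/-- The hash values are taken from the diagonal of the seed, the samples of the darts from the rest
of it. -/
noncomputable def levelEncode (code : Finset V → SetCode V k) (i : ℕ) (G : SimpleGraph V)
    (c : V → Option V) (ω : V × V → Fin (2 ^ l)) : LevelMessage V l k B :=
  (c, fun y => ω (y, y),
    if h : (sampled (2 ^ (l - i)) ω (darts (inner G c))).card ≤ B then ⟨_, h⟩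
      else ⟨∅, Nat.zero_le _⟩,
    fun v j => code (scaleNbrs G c (fun y => ω (y, y)) v j))

/-- The recovered graph consists of the surviving sampled edges and of all edges that can be
recovered from the codes. -/
def levelRecover (dec : SetCode V k → Finset V → Finset V) (m : LevelMessage V l k B)
    (F : Finset (Sym2 V)) : SimpleGraph V :=
  SimpleGraph.fromRel fun x y => ((x, y) ∈ m.2.2.1.1 ∧ s(x, y) ∉ F) ∨
    ∃ j : Fin (l + 1), y ∈ dec (m.2.2.2 x j) (scaleDeleted F m.1 m.2.1 x j)

variable {code : Finset V → SetCode V k} {dec : SetCode V k → Finset V → Finset V}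
  {G : SimpleGraph V} {c : V → Option V} {F : Finset (Sym2 V)} {i : ℕ}

lemma levelRecover_adj_of_sampled {ω : V × V → Fin (2 ^ l)}
    (hB : (sampled (2 ^ (l - i)) ω (darts (inner G c))).card ≤ B) {x y : V}
    (hxy : (inner G c).Adj x y) (hω : (ω (x, y) : ℕ) < 2 ^ (l - i)) (hF : s(x, y) ∉ F) :
    (levelRecover dec (levelEncode code i G c ω : LevelMessage V l k B) F).Adj x y := by
  refine (SimpleGraph.fromRel_adj _ _ _).2 ⟨hxy.ne, Or.inl (Or.inl ⟨?_, hF⟩)⟩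
  simp only [levelEncode, dif_pos hB]
  exact mem_sampled.2 ⟨mem_darts.2 hxy, hω⟩

variable [DecidableEq V]

lemma mem_dec_iff
    (hdec : ∀ S D : Finset V, D ⊆ S → dec (code S) D = if (S \ D).card ≤ k then S \ D else ∅)
    (hF : (F : Set (Sym2 V)) ⊆ G.edgeSet) (h : V → Fin (2 ^ l)) (x y : V) (j : ℕ) :
    y ∈ dec (code (scaleNbrs G c h x j)) (scaleDeleted F c h x j) ↔
      ((survivors G c F x).filter fun z => (h z : ℕ) < 2 ^ (l - j)).card ≤ k ∧
        y ∈ survivors G c F x ∧ (h y : ℕ) < 2 ^ (l - j) := by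
  rw [hdec _ _ (scaleDeleted_subset hF c h x j), scaleNbrs_sdiff]
  split_ifs with hk <;> simp [hk]

lemma levelRecover_le
    (hdec : ∀ S D : Finset V, D ⊆ S → dec (code S) D = if (S \ D).card ≤ k then S \ D else ∅)
    (hF : (F : Set (Sym2 V)) ⊆ G.edgeSet) (ω : V × V → Fin (2 ^ l)) :
    levelRecover dec (levelEncode code i G c ω : LevelMessage V l k B) F
      ≤ (inner G c).deleteEdges (F : Set (Sym2 V)) := by
  suffices h : ∀ x y, (((x, y) ∈ (levelEncode code i G c ω : LevelMessage V l k B).2.2.1.1 ∧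
      s(x, y) ∉ F) ∨ ∃ j : Fin (l + 1), y ∈ dec (code (scaleNbrs G c (fun y => ω (y, y)) x j))
        (scaleDeleted F c (fun y => ω (y, y)) x j)) →
      ((inner G c).deleteEdges (F : Set (Sym2 V))).Adj x y by
    intro x y hxy
    rcases ((SimpleGraph.fromRel_adj _ _ _).1 hxy).2 with h' | h'
    · exact h x y h'
    · exact (h y x h').symm
  rintro x y (⟨h1, h2⟩ | ⟨j, hj⟩)
  · simp only [levelEncode] at h1
    split_ifs at h1
    · rw [mem_sampled, mem_darts] at h1
      exact SimpleGraph.deleteEdges_adj.2 ⟨h1.1, h2⟩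
    · simp at h1
  · exact mem_nbrs.1 ((mem_dec_iff hdec hF _ x y j).1 hj).2.1

lemma levelRecover_adj_of_scale
    (hdec : ∀ S D : Finset V, D ⊆ S → dec (code S) D = if (S \ D).card ≤ k then S \ D else ∅)
    (hF : (F : Set (Sym2 V)) ⊆ G.edgeSet) {ω : V × V → Fin (2 ^ l)} {x : V} {j : ℕ} (hj : j ≤ l)
    (hk : ((survivors G c F x).filter fun z => (ω (z, z) : ℕ) < 2 ^ (l - j)).card ≤ k)
    {y : V} (hy : y ∈ survivors G c F x) (hω : (ω (y, y) : ℕ) < 2 ^ (l - j)) :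
    (levelRecover dec (levelEncode code i G c ω : LevelMessage V l k B) F).Adj x y := by
  refine (SimpleGraph.fromRel_adj _ _ _).2 ⟨(mem_nbrs.1 hy).ne, Or.inl (Or.inr ?_)⟩
  exact ⟨⟨j, Nat.lt_succ_of_le hj⟩, (mem_dec_iff hdec hF (fun y => ω (y, y)) x y j).2 ⟨hk, hy, hω⟩⟩

lemma two_pow_sub_div {i l : ℕ} (h : i ≤ l) :
    (((2 ^ (l - i) : ℕ) : ℝ) / ((2 ^ l : ℕ) : ℝ)) = 1 / 2 ^ i := by
  rw [div_eq_div_iff (by positivity) (by positivity), one_mul]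
  norm_cast
  rw [← pow_add, Nat.sub_add_cancel h]

/-- A large set is sampled at some scale into a set of cardinality between `D` and `32 D`: choose
the scale at which the expected cardinality is between `4 D` and `8 D`. -/
lemma prob_no_scale_le {ι : Type*} [Fintype ι] [DecidableEq ι] {D : ℕ} (hD : 0 < D) (T : Finset ι)
    (hT : 32 * D < T.card) (hl : T.card ≤ 2 ^ l) :
    prob (fun ω : ι → Fin (2 ^ l) => ∀ j ≤ l, ¬ (D ≤ (sampled (2 ^ (l - j)) ω T).card ∧
      (sampled (2 ^ (l - j)) ω T).card ≤ 32 * D)) ≤ 2 * Real.exp (-D) := by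
  set j := Nat.log 2 (T.card / (4 * D)) with hj
  have hq : T.card / (4 * D) ≠ 0 := (Nat.div_pos (by omega) (by omega)).ne'
  have h1 : 2 ^ j * (4 * D) ≤ T.card :=
    (Nat.le_div_iff_mul_le (by omega)).1 (Nat.pow_log_le_self 2 hq)
  have h2 : T.card < 2 ^ (j + 1) * (4 * D) :=
    (Nat.div_lt_iff_lt_mul (by omega)).1 (Nat.lt_pow_succ_log_self (by norm_num) _)
  have hjl : j ≤ l := by
    refine (Nat.pow_le_pow_iff_right (a := 2) (by norm_num)).1 (le_trans ?_ (h1.trans hl))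
    exact Nat.le_mul_of_pos_right _ (by omega)
  have ha : 2 ^ (l - j) ≤ 2 ^ l := Nat.pow_le_pow_right (by norm_num) (Nat.sub_le _ _)
  have hμ : (((2 ^ (l - j) : ℕ) : ℝ) / ((2 ^ l : ℕ) : ℝ)) * T.card = T.card / 2 ^ j := by
    rw [two_pow_sub_div hjl]; ring
  have hμ1 : (4 * D : ℝ) ≤ T.card / 2 ^ j := by
    rw [le_div_iff₀ (by positivity)]
    exact_mod_cast (mul_comm _ _).trans_le h1
  have hμ2 : (T.card / 2 ^ j : ℝ) ≤ 8 * D := by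
    rw [div_le_iff₀ (by positivity)]
    have : (T.card : ℝ) ≤ 2 ^ (j + 1) * (4 * D) := by exact_mod_cast h2.le
    rw [pow_succ] at this
    linarith
  have hlow := prob_card_sampled_le_le ha T D
  have hup := prob_le_card_sampled_le ha T (32 * D)
  rw [hμ] at hlow hup
  have h2e : (2 : ℝ) ≤ Real.exp 1 := by linarith [Real.add_one_le_exp (1 : ℝ)]
  have he2 : Real.exp (9 / 32) ≤ 2 := by
    have h := Real.log_two_gt_d9
    rw [← Real.le_log_iff_exp_le (by norm_num)]
    linarith
  refine (prob_mono (E' := fun ω => (sampled (2 ^ (l - j)) ω T).card ≤ D ∨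
    32 * D ≤ (sampled (2 ^ (l - j)) ω T).card) fun ω h => ?_).trans ((prob_or_le _ _).trans ?_)
  · have := h j hjl
    omega
  have hlow' : (2 : ℝ) ^ D * Real.exp (-(T.card / 2 ^ j / 2)) ≤ Real.exp (-D) := by
    calc (2 : ℝ) ^ D * Real.exp (-(T.card / 2 ^ j / 2))
        ≤ Real.exp 1 ^ D * Real.exp (-(2 * D)) := by gcongr; linarith
      _ = Real.exp (-D) := by rw [← Real.exp_nat_mul, ← Real.exp_add]; ring_nf
  have hup' : Real.exp (T.card / 2 ^ j) / 2 ^ (32 * D) ≤ Real.exp (-D) := by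
    calc Real.exp (T.card / 2 ^ j) / 2 ^ (32 * D)
        ≤ Real.exp (8 * D) / Real.exp (9 / 32) ^ (32 * D) := by gcongr
      _ = Real.exp (-D) := by
        rw [← Real.exp_nat_mul, ← Real.exp_sub]; congr 1; push_cast; ring
  linarith

/-- The level sketch works with high probability if the classes of `c` are expanders. -/
theorem prob_level_fail_le {φ X ε : ℝ} {T D f : ℕ} [Nonempty V]
    (hdec : ∀ S D' : Finset V, D' ⊆ S →
      dec (code S) D' = if (S \ D').card ≤ 32 * D then S \ D' else ∅)
    (hk : k = 32 * D) (hB : 4 * (Fintype.card V * D) ≤ B) (hD : 0 < D)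
    (hφ : 0 < φ) (hφ16 : φ ≤ 16) (hX : Real.log (2 * Fintype.card V) ≤ X) (hφX : φ * X ≤ 8)
    (hT : X * Real.exp (-(φ / 16 * T)) < Real.log 2)
    (hf : (f : ℝ) ≤ φ / 16 * (D * D)) (hε : Real.exp (-(φ / 16 * D)) ≤ ε)
    (hnε : Fintype.card V * ε ≤ 1 / 2) (hl : Fintype.card V ≤ 2 ^ l) (hi : i ≤ l)
    (hG : (darts G).card ≤ Fintype.card V * (D * 2 ^ i))
    (hexp : ∀ (U : Finset V) (γ : Option V), U.Nonempty → U ⊆ part c γ →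
      φ * (∑ v ∈ U, ((nbrs G v).card + D * 2 ^ i : ℝ)) *
        Real.log ((∑ v ∈ part c γ, ((nbrs G v).card + D * 2 ^ i : ℝ)) /
          ∑ v ∈ U, ((nbrs G v).card + D * 2 ^ i : ℝ)) ≤ 2 * (boundary G c U).card)
    (hF : (F : Set (Sym2 V)) ⊆ G.edgeSet) (hFf : F.card ≤ f) :
    prob (fun ω : V × V → Fin (2 ^ l) => ¬ StretchAtMost (2 * (T + 1))
      ((inner G c).deleteEdges (F : Set (Sym2 V)))
      (levelRecover dec (levelEncode code i G c ω : LevelMessage V l k B) F))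
      ≤ 7 * (Fintype.card V * ε) := by
  subst hk
  have ha : 2 ^ (l - i) ≤ 2 ^ l := Nat.pow_le_pow_right (by norm_num) (Nat.sub_le _ _)
  have hDpos : (0 : ℝ) < D := by exact_mod_cast hD
  have hn1 : (1 : ℝ) ≤ Fintype.card V := by exact_mod_cast Fintype.card_pos
  have hε0 : 0 < ε := (Real.exp_pos _).trans_le hε
  have hDε : Real.exp (-D) ≤ ε := by
    refine le_trans (Real.exp_le_exp.2 (neg_le_neg ?_)) hε
    exact mul_le_of_le_one_left hDpos.le (by linarith)
  let E₁ : (V × V → Fin (2 ^ l)) → Prop := fun ω => ∃ U W : Finset V, U.Nonempty ∧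
    φ / 16 * (D * 2 ^ i) * (U.card + W.card) ≤ (freeDarts G c F U W).card ∧
    sampled (2 ^ (l - i)) ω (freeDarts G c F U W) = ∅
  let E₂ : (V × V → Fin (2 ^ l)) → Prop := fun ω =>
    4 * (Fintype.card V * D) ≤ (sampled (2 ^ (l - i)) ω (darts (inner G c))).card
  let E₃ : V → (V × V → Fin (2 ^ l)) → Prop := fun v ω => 32 * D < (survivors G c F v).card ∧
    ∀ j ≤ l, ¬ (D ≤ (sampled (2 ^ (l - j)) ω ((survivors G c F v).map (diagEmb V))).card ∧
      (sampled (2 ^ (l - j)) ω ((survivors G c F v).map (diagEmb V))).card ≤ 32 * D)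
  have h₁ : prob E₁ ≤ 4 * (Fintype.card V * ε) := by
    refine prob_exists_unsampled_le ha (freeDarts G c F) ?_ hnε
    rw [two_pow_sub_div hi]
    convert hε using 3
    field_simp
  have h₂ : prob E₂ ≤ ε := by
    refine (prob_le_card_sampled_le ha _ _).trans (le_trans ?_ hDε)
    rw [two_pow_sub_div hi]
    have hle : 1 / 2 ^ i * ((darts (inner G c)).card : ℝ) ≤ (Fintype.card V * D : ℕ) := by
      have h : (darts (inner G c)).card ≤ (darts G).card := by
        refine Finset.card_le_card fun p hp => ?_
        rw [mem_darts] at hp ⊢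
        exact hp.1
      have h' : ((darts (inner G c)).card : ℝ) ≤ Fintype.card V * (D * 2 ^ i) := by
        exact_mod_cast h.trans hG
      rw [one_div, inv_mul_le_iff₀ (by positivity)]
      push_cast
      linarith
    have he : Real.exp (1 / 2) ≤ 2 := by
      rw [← Real.le_log_iff_exp_le (by norm_num)]
      linarith [Real.log_two_gt_d9]
    calc Real.exp (1 / 2 ^ i * ((darts (inner G c)).card : ℝ)) / 2 ^ (4 * (Fintype.card V * D))
        ≤ Real.exp ((Fintype.card V * D : ℕ)) / Real.exp (1 / 2) ^ (4 * (Fintype.card V * D)) := by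
          gcongr
      _ = Real.exp (-(Fintype.card V * D)) := by
          rw [← Real.exp_nat_mul, ← Real.exp_sub]; congr 1; push_cast; ring
      _ ≤ Real.exp (-D) := by
          gcongr
          exact le_mul_of_one_le_left hDpos.le hn1
  have h₃ : ∀ v, prob (E₃ v) ≤ 2 * ε := by
    intro v
    by_cases hv : 32 * D < (survivors G c F v).card
    · refine (prob_mono fun ω h => h.2).trans ((prob_no_scale_le hD _ ?_ ?_).trans ?_)
      · rwa [Finset.card_map]
      · rw [Finset.card_map]
        exact (Finset.card_le_univ _).trans hl
      · linarith
    · rw [prob_eq_zero fun ω h => hv h.1]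
      positivity
  refine (prob_mono (E' := fun ω => E₁ ω ∨ (E₂ ω ∨ ∃ v, E₃ v ω)) fun ω hbad => ?_).trans ?_
  · by_contra! hgood
    obtain ⟨hg₁, hg₂, hg₃⟩ := hgood
    have hsample : (sampled (2 ^ (l - i)) ω (darts (inner G c))).card ≤ B :=
      (not_le.1 hg₂).le.trans hB
    refine hbad (stretchAtMost_of_expansion (D := D) (d := D * 2 ^ i) (by positivity) hφ hφ16
      (by exact_mod_cast hG) hX hφX hT hexp ?_ (levelRecover_le hdec hF ω) ?_ ?_)
    · refine le_trans (by exact_mod_cast hFf) (hf.trans ?_)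
      gcongr
      exact le_mul_of_one_le_right hDpos.le (one_le_pow₀ (by norm_num))
    · intro U W hU hUW
      have hne : sampled (2 ^ (l - i)) ω (freeDarts G c F U W) ≠ ∅ := fun h =>
        hg₁ ⟨U, W, hU, hUW, h⟩
      obtain ⟨p, hp⟩ := Finset.nonempty_iff_ne_empty.2 hne
      obtain ⟨hpA, hpω⟩ := mem_sampled.1 hp
      obtain ⟨hp1, -, hp3⟩ := mem_freeDarts.1 hpA
      exact ⟨p, hpA, levelRecover_adj_of_sampled hsample ⟨hp1.1, hp1.2.2.2⟩ hpω hp3⟩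
    · intro v
      by_cases hv : 32 * D < (survivors G c F v).card
      · right
        have h := hg₃ v
        simp only [E₃, not_and, not_forall, not_not] at h
        obtain ⟨j, hj, hj1, hj2⟩ := h hv
        rw [card_sampled_diag] at hj1 hj2
        refine hj1.trans (Finset.card_le_card fun y hy => mem_nbrs.2 ?_)
        obtain ⟨hy1, hy2⟩ := Finset.mem_filter.1 hy
        exact levelRecover_adj_of_scale hdec hF hj hj2 hy1 hy2
      · left
        intro y hy
        -- at scale `0` every neighbour is sampled
        exact levelRecover_adj_of_scale hdec hF (Nat.zero_le l)
          ((Finset.card_filter_le _ _).trans (not_lt.1 hv)) (mem_nbrs.2 hy) (ω (y, y)).2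
  · refine (prob_or_le _ _).trans ?_
    have h23 := prob_or_le E₂ fun ω => ∃ v, E₃ v ω
    have h3 : prob (fun ω => ∃ v, E₃ v ω) ≤ Fintype.card V * (2 * ε) := by
      refine (prob_exists_le _).trans ((Finset.sum_le_sum fun v _ => h₃ v).trans ?_)
      simp
    have : ε ≤ Fintype.card V * ε := le_mul_of_one_le_left hε0.le hn1
    linarith

lemma card_subtype_card_le_le (hl : Fintype.card V + 1 ≤ 2 ^ l) :
    Fintype.card {R : Finset (V × V) // R.card ≤ B} ≤ 2 ^ (2 * l * B) := by
  rw [Fintype.card_subtype]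
  refine (card_filter_card_le_le (V × V) B).trans ?_
  rw [pow_mul]
  refine Nat.pow_le_pow_left ?_ B
  calc Fintype.card (V × V) + 1 ≤ (Fintype.card V + 1) ^ 2 := by
        rw [Fintype.card_prod]; nlinarith
    _ ≤ (2 ^ l) ^ 2 := Nat.pow_le_pow_left hl 2
    _ = 2 ^ (2 * l) := by rw [← pow_mul, mul_comm]

lemma card_levelMessage_le (hl : Fintype.card V + 1 ≤ 2 ^ l) :
    Fintype.card (LevelMessage V l k B) ≤ 2 ^ (l * Fintype.card V + (l * Fintype.card V +
      ((2 * l) * B + (l + (l * (2 * k) + 1)) * (l + 1) * Fintype.card V))) := by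
  have hpow : ∀ a m : ℕ, a ≤ 2 ^ l → a ^ m ≤ 2 ^ (l * m) := fun a m h =>
    (Nat.pow_le_pow_left h m).trans_eq (pow_mul _ _ _).symm
  have hC : (Fintype.card V + 1) * ((Fintype.card V + 1) ^ (2 * k) + 1)
      ≤ 2 ^ (l + (l * (2 * k) + 1)) := by
    rw [pow_add, pow_succ]
    refine Nat.mul_le_mul hl ?_
    have h1 := hpow _ (2 * k) hl
    have h2 : 1 ≤ 2 ^ (l * (2 * k)) := Nat.one_le_two_pow
    omega
  simp only [LevelMessage, SetCode, Fintype.card_prod, Fintype.card_fun, Fintype.card_option,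
    Fintype.card_fin]
  rw [pow_add 2 (l * Fintype.card V), pow_add 2 (l * Fintype.card V), pow_add 2 (2 * l * B)]
  refine Nat.mul_le_mul (hpow _ _ hl) (Nat.mul_le_mul (pow_mul 2 l _).ge (Nat.mul_le_mul (card_subtype_card_le_le hl) ?_))
  rw [pow_mul 2 ((l + (l * (2 * k) + 1)) * (l + 1)), pow_mul 2 (l + (l * (2 * k) + 1))]
  exact Nat.pow_le_pow_left (Nat.pow_le_pow_left hC _) _

end LevelSketch

/-! ### Composition of the levels -/

section Composition

/-- There is a sketch of `s` bits, with seeds in `V × V → Fin (2 ^ l)`, for graphs with at most `N`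
darts, which fails with probability at most `δ` to recover a spanner of stretch `τ` when at most `f`
edges are deleted. Messages are elements of a type with at most `2 ^ s` elements. -/
def Sketchable (V : Type) [Fintype V] [DecidableEq V] (l N f τ s : ℕ) (δ : ℝ) : Prop :=
  ∃ (M : Type) (_ : Fintype M) (enc : SimpleGraph V → (V × V → Fin (2 ^ l)) → M)
    (dec : M → Finset (Sym2 V) → SimpleGraph V), Fintype.card M ≤ 2 ^ s ∧
    ∀ (G : SimpleGraph V) (F : Finset (Sym2 V)), (darts G).card ≤ N →
      (F : Set (Sym2 V)) ⊆ G.edgeSet → F.card ≤ f →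
      prob (fun ω => ¬ StretchAtMost τ (G.deleteEdges (F : Set (Sym2 V))) (dec (enc G ω) F)) ≤ δ

variable {V : Type}

lemma card_cutDarts [Fintype V] (G : SimpleGraph V) (c : V → Option V) :
    (darts (outer G c)).card = (cutDarts G c).card := by
  congr 1
  ext p
  rw [mem_darts, mem_cutDarts]
  rfl

lemma StretchAtMost.sup_inner_outer {G H₁ H₂ : SimpleGraph V} {c : V → Option V}
    {S : Set (Sym2 V)} {τ : ℕ} (h₁ : StretchAtMost τ ((inner G c).deleteEdges S) H₁)
    (h₂ : StretchAtMost τ ((outer G c).deleteEdges S) H₂) :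
    StretchAtMost τ (G.deleteEdges S) (H₁ ⊔ H₂) := by
  refine ⟨sup_le (h₁.1.trans fun x y h => ?_) (h₂.1.trans fun x y h => ?_), fun u v huv => ?_⟩
  · rw [SimpleGraph.deleteEdges_adj] at h ⊢
    exact ⟨h.1.1, h.2⟩
  · rw [SimpleGraph.deleteEdges_adj] at h ⊢
    exact ⟨h.1.1, h.2⟩
  · rw [SimpleGraph.deleteEdges_adj] at huv
    by_cases hc : c u = c v
    · obtain ⟨p, hp⟩ := h₁.2 u v (SimpleGraph.deleteEdges_adj.2 ⟨⟨huv.1, hc⟩, huv.2⟩)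
      exact ⟨p.mapLe le_sup_left, by simpa using hp⟩
    · obtain ⟨p, hp⟩ := h₂.2 u v (SimpleGraph.deleteEdges_adj.2 ⟨⟨huv.1, hc⟩, huv.2⟩)
      exact ⟨p.mapLe le_sup_right, by simpa using hp⟩

open Classical in
/-- The deletions between different classes. -/
noncomputable def outerDeletions (c : V → Option V) (F : Finset (Sym2 V)) : Finset (Sym2 V) :=
  F.filter fun e => e ∈ (outer ⊤ c).edgeSet

lemma outerDeletions_subset {G : SimpleGraph V} {F : Finset (Sym2 V)}
    (hF : (F : Set (Sym2 V)) ⊆ G.edgeSet) (c : V → Option V) :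
    (outerDeletions c F : Set (Sym2 V)) ⊆ (outer G c).edgeSet := by
  intro e he
  obtain ⟨he1, he2⟩ : e ∈ F ∧ e ∈ (outer ⊤ c).edgeSet := by simpa [outerDeletions] using he
  have he3 := hF he1
  induction e with
  | _ x y => exact ⟨he3, he2.2⟩

lemma deleteEdges_outerDeletions (G : SimpleGraph V) (c : V → Option V) (F : Finset (Sym2 V)) :
    (outer G c).deleteEdges (outerDeletions c F : Set (Sym2 V))
      = (outer G c).deleteEdges (F : Set (Sym2 V)) := by
  ext x y
  simp only [SimpleGraph.deleteEdges_adj, outerDeletions, Finset.mem_coe, Finset.mem_filter,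
    not_and]
  refine and_congr_right fun h => ⟨fun h' hF => h' hF ⟨h.1.ne, h.2⟩, fun h' hF => absurd hF h'⟩

variable [Fintype V] [DecidableEq V]

/-- A sparse graph is stored explicitly. -/
lemma sketchable_of_card_darts_le {l N f τ : ℕ} (hτ : 1 ≤ τ) (hl : Fintype.card V + 1 ≤ 2 ^ l) :
    Sketchable V l N f τ (2 * l * N) 0 := by
  classical
  refine ⟨{R : Finset (V × V) // R.card ≤ N}, inferInstance,
    fun G _ => if h : (darts G).card ≤ N then ⟨darts G, h⟩ else ⟨∅, Nat.zero_le _⟩,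
    fun R F => SimpleGraph.fromRel fun x y => (x, y) ∈ R.1 ∧ s(x, y) ∉ F,
    card_subtype_card_le_le hl, ?_⟩
  intro G F hG hF hf
  refine (prob_eq_zero fun ω h => h ?_).le
  have heq : (SimpleGraph.fromRel fun x y => (x, y) ∈ darts G ∧ s(x, y) ∉ F)
      = G.deleteEdges (F : Set (Sym2 V)) := by
    ext x y
    simp only [SimpleGraph.fromRel_adj, mem_darts, SimpleGraph.deleteEdges_adj, Finset.mem_coe,
      Sym2.eq_swap (a := y), G.adj_comm y x, or_self, and_iff_right_iff_imp]
    exact fun h => h.1.ne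
  simp only [dif_pos hG, heq]
  exact ⟨le_rfl, fun u v huv => ⟨huv.toWalk, by simpa using hτ⟩⟩

/-- The number of bits of the sketch of one level. -/
def levelBits (n l D : ℕ) : ℕ :=
  l * n + (l * n + ((2 * l) * (4 * (n * D)) + (l + (l * (2 * (32 * D)) + 1)) * (l + 1) * n))

/-- One level: the graph is decomposed into expanders, the edges inside which are handled by the
level sketch, and at most half of the edges, those between the expanders, are left over. -/
theorem Sketchable.succ_level {φ ε δ : ℝ} {T D f l i s : ℕ} [Nonempty V]
    (h : Sketchable V l (Fintype.card V * (D * 2 ^ i)) f (2 * (T + 1)) s δ) (hD : 0 < D)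
    (hφ : 0 < φ) (hφ16 : φ ≤ 16) (hφX : φ * Real.log (2 * Fintype.card V) ≤ 1 / 4)
    (hT : Real.log (2 * Fintype.card V) * Real.exp (-(φ / 16 * T)) < Real.log 2)
    (hf : (f : ℝ) ≤ φ / 16 * (D * D)) (hε : Real.exp (-(φ / 16 * D)) ≤ ε)
    (hnε : Fintype.card V * ε ≤ 1 / 2) (hl : Fintype.card V + 1 ≤ 2 ^ l) (hi : i + 1 ≤ l) :
    Sketchable V l (Fintype.card V * (D * 2 ^ (i + 1))) f (2 * (T + 1))
      (levelBits (Fintype.card V) l D + s) (7 * (Fintype.card V * ε) + δ) := by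
  classical
  obtain ⟨M, _, enc, dec, hM, hdec⟩ := h
  obtain ⟨code, sdec, hsdec⟩ := exists_sparse_recovery V (32 * D)
  have hDpos : (0 : ℝ) < D := by exact_mod_cast hD
  have hd : (0 : ℝ) < D * 2 ^ (i + 1) := by positivity
  have hdecomp := fun G : SimpleGraph V => exists_expander_decomposition G
    (fun v => ((nbrs G v).card + D * 2 ^ (i + 1) : ℝ)) hd (fun v => by simp) hφ.le
  choose c hcut hexp using hdecomp
  refine ⟨LevelMessage V l (32 * D) (4 * (Fintype.card V * D)) × M, inferInstance,
    fun G ω => (levelEncode code (i + 1) G (c G) ω, enc (outer G (c G)) ω),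
    fun m F => levelRecover sdec m.1 F ⊔ dec m.2 (outerDeletions m.1.1 F), ?_, ?_⟩
  · rw [Fintype.card_prod, pow_add]
    exact Nat.mul_le_mul (card_levelMessage_le hl) hM
  · intro G F hG hF hFf
    have hin := prob_level_fail_le (B := 4 * (Fintype.card V * D)) hsdec rfl le_rfl hD hφ hφ16
      le_rfl (hφX.trans (by norm_num)) hT hf hε hnε ((Nat.le_succ _).trans hl) hi hG (hexp G) hF hFf
    have hout : (darts (outer G (c G))).card ≤ Fintype.card V * (D * 2 ^ i) := by
      rw [card_cutDarts]
      have hG' : ((darts G).card : ℝ) ≤ Fintype.card V * (D * 2 ^ (i + 1)) := by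
        exact_mod_cast hG
      have hn : (0 : ℝ) < Fintype.card V := by exact_mod_cast Fintype.card_pos
      have hw : ∑ v, ((nbrs G v).card + D * 2 ^ (i + 1) : ℝ)
          = (darts G).card + Fintype.card V * (D * 2 ^ (i + 1)) := by
        have h1 : (∑ v, ((nbrs G v).card : ℝ)) = (darts G).card := by
          exact_mod_cast sum_card_nbrs G
        rw [Finset.sum_add_distrib, h1, Finset.sum_const, Finset.card_univ, nsmul_eq_mul]
      have hcutG := hcut G
      rw [hw] at hcutG
      set W : ℝ := (darts G).card + Fintype.card V * (D * 2 ^ (i + 1)) with hW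
      have hnd : 0 < Fintype.card V * (D * 2 ^ (i + 1) : ℝ) := by positivity
      have hWpos : 0 < W := by positivity
      have hlog : Real.log (W / (D * 2 ^ (i + 1))) ≤ Real.log (2 * Fintype.card V) := by
        refine Real.log_le_log (by positivity) ?_
        rw [div_le_iff₀ hd]
        linarith
      have h2 : φ * W * Real.log (W / (D * 2 ^ (i + 1))) ≤ W * (1 / 4) := by
        calc φ * W * Real.log (W / (D * 2 ^ (i + 1)))
            ≤ φ * W * Real.log (2 * Fintype.card V) := by gcongr
          _ = W * (φ * Real.log (2 * Fintype.card V)) := by ring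
          _ ≤ W * (1 / 4) := by gcongr
      have h3 : ((cutDarts G (c G)).card : ℝ) ≤ Fintype.card V * (D * 2 ^ i) := by
        rw [pow_succ] at hW hG'
        linarith
      exact_mod_cast h3
    have hrec := hdec (outer G (c G)) (outerDeletions (c G) F) hout
      (outerDeletions_subset hF _) ((Finset.card_filter_le _ _).trans hFf)
    rw [deleteEdges_outerDeletions] at hrec
    refine (prob_mono fun ω hω => ?_).trans ((prob_or_le _ _).trans (add_le_add hin hrec))
    by_contra! hgood
    exact hω (hgood.1.sup_inner_outer hgood.2)

theorem sketchable_level {φ ε : ℝ} {T D f l : ℕ} [Nonempty V] (hD : 0 < D)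
    (hφ : 0 < φ) (hφ16 : φ ≤ 16) (hφX : φ * Real.log (2 * Fintype.card V) ≤ 1 / 4)
    (hT : Real.log (2 * Fintype.card V) * Real.exp (-(φ / 16 * T)) < Real.log 2)
    (hf : (f : ℝ) ≤ φ / 16 * (D * D)) (hε : Real.exp (-(φ / 16 * D)) ≤ ε)
    (hnε : Fintype.card V * ε ≤ 1 / 2) (hl : Fintype.card V + 1 ≤ 2 ^ l) (i : ℕ) (hi : i ≤ l) :
    Sketchable V l (Fintype.card V * (D * 2 ^ i)) f (2 * (T + 1))
      (i * levelBits (Fintype.card V) l D + 2 * l * (Fintype.card V * D))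
      (i * (7 * (Fintype.card V * ε))) := by
  induction i with
  | zero =>
    simpa using sketchable_of_card_darts_le (V := V) (l := l) (N := Fintype.card V * D) (f := f)
      (τ := 2 * (T + 1)) (by omega) hl
  | succ i ih =>
    convert (ih (by omega)).succ_level hD hφ hφ16 hφX hT hf hε hnε hl hi using 1
    · ring
    · push_cast; ring

/-- A sketch with messages in a finite type, applied to all graphs, is a randomized sketch with a
uniformly distributed seed. -/
theorem Sketchable.exists_randomizedSketch {n l N f τ s : ℕ} {δ t : ℝ}
    (h : Sketchable (Fin n) l N f τ s δ) (hN : n * n ≤ N) (ht : τ ≤ t) :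
    ∃ S : RandomizedSketch n s, ∀ (G : SimpleGraph (Fin n)) (F : Finset (Sym2 (Fin n))),
      (F : Set (Sym2 (Fin n))) ⊆ G.edgeSet → F.card ≤ f → 1 - δ ≤ S.successProb t G F := by
  classical
  obtain ⟨M, _, enc, dec, hM, hdec⟩ := h
  have : Nonempty M := ⟨enc ⊥ fun _ => 0⟩
  obtain ⟨e⟩ : Nonempty (M ↪ (Fin s → Bool)) :=
    Function.Embedding.nonempty_of_card_le (by simpa using hM)
  refine ⟨⟨Fin n × Fin n → Fin (2 ^ l), PMF.uniformOfFintype _, fun G ω => e (enc G ω),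
    fun b F => dec (Function.invFun e b) F⟩, fun G F hF hf => ?_⟩
  have hG : (darts G).card ≤ N := (Finset.card_le_univ _).trans (by simpa using hN)
  have hfail := hdec G F hG hF hf
  have hsum := prob_not_add fun ω =>
    StretchAtMost τ (G.deleteEdges (F : Set (Sym2 (Fin n)))) (dec (enc G ω) F)
  have hmono : prob (fun ω => StretchAtMost τ (G.deleteEdges (F : Set (Sym2 (Fin n))))
      (dec (enc G ω) F)) ≤ prob fun ω => IsSpanner t (G.deleteEdges (F : Set (Sym2 (Fin n))))
      (dec (enc G ω) F) := prob_mono fun ω hω => hω.isSpanner ht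
  refine le_trans (by linarith) (hmono.trans (le_of_eq ?_))
  rw [RandomizedSketch.successProb, PMF.toOuterMeasure_uniformOfFintype_apply]
  simp only [Function.leftInverse_invFun e.injective (enc _ _), prob]
  rw [ENNReal.toReal_div, ENNReal.toReal_natCast, ENNReal.toReal_natCast]
  congr 2
  rw [← Set.toFinset_card]
  congr 1
  ext ω
  simp

end Composition

/-! ### The choice of the parameters -/

lemma one_lt_log_of_three_le {n : ℕ} (hn : 3 ≤ n) : 1 < Real.log n := by
  rw [Real.lt_log_iff_exp_lt (by positivity)]
  have h3 : (3 : ℝ) ≤ n := by exact_mod_cast hn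
  linarith [Real.exp_one_lt_d9]

lemma clog_le {n : ℕ} (hn : 3 ≤ n) :
    Nat.clog 2 (n + 1) ≤ n ∧ (Nat.clog 2 (n + 1) : ℝ) ≤ 3 * Real.log n := by
  set l := Nat.clog 2 (n + 1)
  have hpos : 0 < l := Nat.clog_pos (by norm_num) (by omega)
  have h1 : 2 ^ (l - 1) < n + 1 := Nat.pow_pred_clog_lt_self (by norm_num) (by omega)
  have h2 : l - 1 < 2 ^ (l - 1) := Nat.lt_two_pow_self
  refine ⟨by omega, ?_⟩
  have h3 : (2 : ℝ) ^ (l - 1) ≤ n := by exact_mod_cast Nat.lt_succ_iff.1 h1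
  have h4 := Real.log_le_log (by positivity) h3
  rw [Real.log_pow, Nat.cast_sub (by omega)] at h4
  have h5 : ((l : ℝ) - 1) * (1 / 2) ≤ (l - 1) * Real.log 2 := by
    have h6 : (1 : ℝ) ≤ l := by exact_mod_cast hpos
    refine mul_le_mul_of_nonneg_left ?_ (by linarith)
    linarith [Real.log_two_gt_d9]
  have h7 := one_lt_log_of_three_le hn
  push_cast at h4
  linarith

lemma levelBits_le {n l D : ℕ} (hl : 1 ≤ l) (hD : 1 ≤ D) :
    l * levelBits n l D + 2 * l * (n * D) ≤ 144 * (n * D * l ^ 3) := by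
  have h1 : levelBits n l D ≤ 142 * (n * D * l ^ 2) := by
    have ha : l * n ≤ n * D * l ^ 2 := by
      calc l * n = n * 1 * l ^ 1 := by ring
        _ ≤ n * D * l ^ 2 := by gcongr; norm_num
    have hb : (2 * l) * (4 * (n * D)) ≤ 8 * (n * D * l ^ 2) := by
      calc (2 * l) * (4 * (n * D)) = 8 * (n * D * l ^ 1) := by ring
        _ ≤ _ := by gcongr; norm_num
    have hc : (l + (l * (2 * (32 * D)) + 1)) * (l + 1) * n ≤ 132 * (n * D * l ^ 2) := by
      have h2 : l + (l * (2 * (32 * D)) + 1) ≤ 66 * (l * D) := by nlinarith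
      calc (l + (l * (2 * (32 * D)) + 1)) * (l + 1) * n ≤ 66 * (l * D) * (2 * l) * n := by
            gcongr; omega
        _ = _ := by ring
    unfold levelBits
    omega
  calc l * levelBits n l D + 2 * l * (n * D)
      ≤ l * (142 * (n * D * l ^ 2)) + 2 * (n * D * l ^ 3) := by
        refine add_le_add (Nat.mul_le_mul_left _ h1) ?_
        calc 2 * l * (n * D) = 2 * (n * D * l ^ 1) := by ring
          _ ≤ _ := by gcongr; norm_num
    _ = _ := by ring

/-- The bound for twice the number of growth steps, where `L = log n`. It is the lower bound `κ` for
`log L` that allows lower order terms to be absorbed in `L * log L`. -/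
lemma stretch_le {L κ : ℝ} (hκ : 0 < κ) (hL : 1 < L) (hκL : κ ≤ Real.log L) :
    ((2 * (⌈128 * L * Real.log (4 * L)⌉₊ + 1) : ℕ) : ℝ)
      ≤ (256 + 516 / κ) * (L * Real.log L) := by
  have h4 : Real.log 4 ≤ 2 := by
    rw [show (4 : ℝ) = 2 ^ 2 by norm_num, Real.log_pow]
    push_cast
    linarith [Real.log_two_lt_d9]
  have h1 : Real.log (4 * L) ≤ 2 + Real.log L := by
    rw [Real.log_mul (by norm_num) (by linarith)]
    linarith
  have h0 : 0 ≤ 128 * L * Real.log (4 * L) :=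
    mul_nonneg (by linarith) (Real.log_nonneg (by linarith))
  have h2 := (Nat.ceil_lt_add_one h0).le
  have h3 : 128 * L * Real.log (4 * L) ≤ 128 * L * (2 + Real.log L) := by gcongr
  have h5 : L * 1 ≤ L * (Real.log L / κ) := by
    gcongr
    rwa [one_le_div hκ]
  have h6 : (256 + 516 / κ) * (L * Real.log L)
      = 256 * (L * Real.log L) + 516 * (L * (Real.log L / κ)) := by ring
  rw [h6]
  push_cast
  linarith

/-- The sketch for explicit parameters: expansion `φ = 1 / (8 log n)`, degree threshold `D` of order
`√f log² n`, seed values below `2 ^ l ≥ n + 1`, failure probability `n ^ (-110)` of a single bad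
event, and `T` of order `log n log log n` growth steps. The constant in the size is
`144 * 28160 * 3 ^ 3`. -/
theorem exists_sketch {κ : ℝ} (hκ : 0 < κ) (hκ3 : κ ≤ Real.log (Real.log 3)) {n : ℕ} (f : ℕ)
    (hn : 3 ≤ n) :
    ∃ (s : ℕ) (S : RandomizedSketch n s),
      (s : ℝ) ≤ 109486080 * ((n : ℝ) * Real.sqrt (max (f : ℝ) 1)) * Real.log (n : ℝ) ^ 5 ∧
      ∀ (G : SimpleGraph (Fin n)) (F : Finset (Sym2 (Fin n))),
        (F : Set (Sym2 (Fin n))) ⊆ G.edgeSet → F.card ≤ f →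
          1 - 1 / (n : ℝ) ^ 100 ≤ S.successProb
            ((256 + 516 / κ) * (Real.log (n : ℝ) * Real.log (Real.log (n : ℝ)))) G F := by
  have hn3 : (3 : ℝ) ≤ n := by exact_mod_cast hn
  have hL := one_lt_log_of_three_le hn
  have hκL : κ ≤ Real.log (Real.log n) := hκ3.trans
    (Real.log_le_log (Real.log_pos (by norm_num))
      (Real.log_le_log (by norm_num) hn3))
  obtain ⟨hln, hlL⟩ := clog_le hn
  have hl1 : 1 ≤ Nat.clog 2 (n + 1) := Nat.clog_pos (by norm_num) (by omega)
  have hl : n + 1 ≤ 2 ^ Nat.clog 2 (n + 1) := Nat.le_pow_clog (by norm_num) _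
  set L := Real.log n
  set l := Nat.clog 2 (n + 1)
  set m : ℝ := max (f : ℝ) 1
  have hm1 : 1 ≤ m := le_max_right _ _
  have hsm : 1 ≤ Real.sqrt m := Real.one_le_sqrt.2 hm1
  have hL2 : 1 ≤ L ^ 2 := one_le_pow₀ hL.le
  -- `14080 = 128 * 110`, so that `φ / 16 * D ≥ 110 * L` for `φ = 1 / (8 * L)`
  set D := ⌈14080 * L ^ 2 * Real.sqrt m⌉₊
  have hDge : 14080 * L ^ 2 * Real.sqrt m ≤ D := Nat.le_ceil _
  have hDle : (D : ℝ) ≤ 28160 * L ^ 2 * Real.sqrt m := by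
    have h1 := (Nat.ceil_lt_add_one (a := 14080 * L ^ 2 * Real.sqrt m) (by positivity)).le
    have h2 : 1 ≤ L ^ 2 * Real.sqrt m := one_le_mul_of_one_le_of_one_le hL2 hsm
    simp only [D]
    linarith
  have hDL : 14080 * L ^ 2 ≤ D := le_trans (le_mul_of_one_le_right (by positivity) hsm) hDge
  have hD : 0 < D := by
    have : (0 : ℝ) < D := lt_of_lt_of_le (by positivity) hDL
    exact_mod_cast this
  set T := ⌈128 * L * Real.log (4 * L)⌉₊
  have : Nonempty (Fin n) := ⟨⟨0, by omega⟩⟩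
  have hlog2n : Real.log (2 * n) ≤ 2 * L := by
    have : Real.log (2 * n) ≤ Real.log (n ^ 2) := Real.log_le_log (by positivity) (by nlinarith)
    rwa [Real.log_pow] at this
  have hlog2n0 : 0 ≤ Real.log (2 * n) := Real.log_nonneg (by linarith)
  have hn110 : Real.exp (-(110 * L)) = 1 / (n : ℝ) ^ 110 := by
    rw [Real.exp_neg, one_div, show (110 : ℝ) * L = (110 : ℕ) * L by norm_num, Real.exp_nat_mul,
      Real.exp_log (by linarith)]
  have hsk := sketchable_level (V := Fin n) (φ := 1 / (8 * L)) (ε := 1 / (n : ℝ) ^ 110) (T := T)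
    (f := f) (l := l) hD (by positivity)
    (by rw [div_le_iff₀ (by positivity)]; linarith)
    (by
      rw [Fintype.card_fin, one_div, inv_mul_le_iff₀ (by positivity)]
      linarith)
    (by
      rw [Fintype.card_fin]
      have h1 : Real.exp (-(1 / (8 * L) / 16 * T)) ≤ 1 / (4 * L) := by
        rw [one_div (4 * L), ← Real.exp_log (show 0 < 4 * L by linarith), ← Real.exp_neg,
          Real.exp_le_exp, neg_le_neg_iff]
        have h2 : 128 * L * Real.log (4 * L) ≤ T := Nat.le_ceil _
        rw [show 1 / (8 * L) / 16 * (T : ℝ) = T / (128 * L) by field_simp; ring,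
          le_div_iff₀ (by linarith)]
        linarith
      calc Real.log (2 * n) * Real.exp (-(1 / (8 * L) / 16 * T)) ≤ 2 * L * (1 / (4 * L)) := by
            gcongr
        _ = 1 / 2 := by field_simp; norm_num
        _ < Real.log 2 := by linarith [Real.log_two_gt_d9])
    (by
      have h1 : (f : ℝ) ≤ m := le_max_left _ _
      have h2 : (14080 * L ^ 2 * Real.sqrt m) * (14080 * L ^ 2 * Real.sqrt m) ≤ D * D := by gcongr
      have h3 : (14080 * L ^ 2 * Real.sqrt m) * (14080 * L ^ 2 * Real.sqrt m)
          = 198246400 * (L ^ 4 * m) := by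
        have := Real.mul_self_sqrt (show 0 ≤ m by linarith)
        linear_combination 198246400 * L ^ 4 * this
      have h4 : L * m ≤ L ^ 4 * m := by
        gcongr
        exact le_self_pow₀ hL.le (by norm_num)
      have h5 : 0 ≤ L * m := by positivity
      rw [show 1 / (8 * L) / 16 * ((D : ℝ) * D) = D * D / (128 * L) by field_simp; norm_num,
        le_div_iff₀ (by linarith)]
      have h6 : (f : ℝ) * (128 * L) ≤ m * (128 * L) := by gcongr
      linarith)
    (by
      rw [← hn110, Real.exp_le_exp, neg_le_neg_iff,
        show 1 / (8 * L) / 16 * (D : ℝ) = D / (128 * L) by field_simp; norm_num,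
        le_div_iff₀ (by linarith)]
      linarith)
    (by
      rw [Fintype.card_fin, mul_one_div, div_le_div_iff₀ (by positivity) (by norm_num)]
      calc (n : ℝ) * 2 ≤ n * n ^ 109 := by
            gcongr
            exact (by linarith : (2 : ℝ) ≤ n).trans (le_self_pow₀ (by linarith) (by norm_num))
        _ = 1 * n ^ 110 := by ring)
    (by rwa [Fintype.card_fin]) l le_rfl
  rw [Fintype.card_fin] at hsk
  obtain ⟨S, hS⟩ := hsk.exists_randomizedSketch
    (by
      refine Nat.mul_le_mul_left _ (le_trans (by omega : n ≤ 2 ^ l) ?_)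
      exact Nat.le_mul_of_pos_left _ hD)
    (stretch_le hκ hL hκL)
  refine ⟨_, S, ?_, fun G F hF hf => le_trans ?_ (hS G F hF hf)⟩
  · calc ((l * levelBits n l D + 2 * l * (n * D) : ℕ) : ℝ) ≤ 144 * (n * D * (l : ℝ) ^ 3) := by
          exact_mod_cast levelBits_le hl1 hD
      _ ≤ 144 * (n * (28160 * L ^ 2 * Real.sqrt m) * (3 * L) ^ 3) := by gcongr
      _ = 109486080 * (n * Real.sqrt m) * L ^ 5 := by ring
  · refine sub_le_sub_left ?_ 1
    have h7 : (7 : ℝ) ≤ n ^ 2 := by nlinarith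
    calc (l : ℝ) * (7 * (n * (1 / (n : ℝ) ^ 110))) ≤ n * (n ^ 2 * (n * (1 / (n : ℝ) ^ 110))) := by
          gcongr
      _ = 1 / (n : ℝ) ^ 106 := by field_simp
      _ ≤ 1 / (n : ℝ) ^ 100 := by
          gcongr
          · linarith
          · norm_num

end ObliviousSpanner

theorem theorem6p1 :
    ∃ (A B : ℝ) (c : ℕ), ∀ n f : ℕ, 3 ≤ n →
      ∃ (s : ℕ) (S : ObliviousSpanner.RandomizedSketch n s),
        (s : ℝ) ≤ A * ((n : ℝ) * Real.sqrt (max (f : ℝ) 1)) * Real.log (n : ℝ) ^ c ∧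
        ∀ (G : SimpleGraph (Fin n)) (F : Finset (Sym2 (Fin n))),
          (F : Set (Sym2 (Fin n))) ⊆ G.edgeSet → F.card ≤ f →
            1 - 1 / (n : ℝ) ^ 100 ≤
              S.successProb (B * (Real.log (n : ℝ) * Real.log (Real.log (n : ℝ)))) G F := by
  -- `log log n` is bounded away from `0` for `n ≥ 3`
  have hκ : 0 < Real.log (Real.log 3) :=
    Real.log_pos (by exact_mod_cast ObliviousSpanner.one_lt_log_of_three_le (le_refl 3))
  exact ⟨_, _, 5, fun n f hn => ObliviousSpanner.exists_sketch hκ le_rfl f hn⟩
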